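/- **Theorem (Convergence of Gevrey-class solutions as $\nu\to0$).** Let $d\ge2$ and $\mathbb{T}^d=[0,2\pi]^d$ with periodic boundary conditions. For $\nu\ge0$ and $1\le i,j\le d$ let $T^\nu_{ij}$ be Fourier multiplier operators on $\mathbb{T}^d$, with symbols $\widehat T^\nu_{ij}(k)$, $k\in\mathbb{Z}^d$, that map real functions to real functions, such that * (A1) $\sum_{i,j}\partial_i\partial_jT^\nu_{ij}f=0$ for all $\nu\ge0$ and all smooth $f$; * (A2) there is $C_0>0$ with $|\widehat T^\nu_{ij}(k)|\le C_0$ for all $i,j$, all $k\in\mathbb{Z}^d$, all $\nu\in(0,1]$, and also for $\nu=0$; * (A5) $\lim_{\nu\to0^+}\sum_{k}|\widehat T^\nu_{ij}(k)-\widehat T^0_{ij}(k)|^2|\widehat g(k)|^2=0$ for all $i,j$ and all $g\in L^2(\mathbb{T}^d)$. For $\tau>0$ put $\|\Lambda^re^{\tau\Lambda^{1/s}}f\|_{L^2}^2=\sum_{k\in\mathbb{Z}^d\setminus\{0\}}|k|^{2r}e^{2\tau|k|^{1/s}}|\widehat f(k)|^2$. Fix $s\ge1$, $r>\frac d2+\frac32$,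 $K_0>0$, $\tau_0>0$, and let $\theta_0,S:\mathbb{T}^d\to\mathbb{R}$ be smooth functions of zero mean with $\|\Lambda^re^{\tau_0\Lambda^{1/s}}\theta_0\|_{L^2}\le K_0$ and $\|\Lambda^re^{\tau_0\Lambda^{1/s}}S\|_{L^2}\le K_0$. Given $\bar T,\bar\tau>0$, call $\theta$ a *Gevrey-class $s$ solution with parameter $\nu$ on $\mathbb{T}^d\times[0,\bar T]$ with radius of convergence at least $\bar\tau$* if each $\theta(\cdot,t)$, $t\in[0,\bar T]$, is smooth, $\sup_{t\in[0,\bar T]}\|\Lambda^re^{\bar\tau\Lambda^{1/s}}\theta(\cdot,t)\|_{L^2}<\infty$, and at every point of $\mathbb{T}^d\times[0,\bar T]$ (with one-sided time derivatives at $t=0$ and $t=\bar T$) $$\partial_t\theta+u\cdot\nabla\theta=S,\qquad u_j=\sum_i\partial_{x_i}T^\nu_{ij}[\theta],\qquad \theta(\cdot,0)=\theta_0 .$$ Let $\theta^\nu$, $\nu\in[0,1]$, be such solutions, all with the same $\bar T$ and $\bar\tau$, and suppose that for some constant $C$ independent of $\nu$ and $t$ $$\|\Lambda^re^{\bar\tau\Lambda^{1/s}}\theta^\nu(\cdot,t)\|_{L^2}\le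 C\qquad(t\in[0,\bar T],\ \nu\in[0,1]).$$ If $s>1$, suppose also that $\theta^0$ is the only such solution with parameter $\nu=0$. (For $s=1$ no uniqueness is assumed.) Then there exist $T\in(0,\bar T)$ and a continuous function $\tau:[0,T]\to(0,\bar\tau)$, both independent of $\nu$, such that for every $t\in[0,T]$ $$\lim_{\nu\to0^+}\big\|\big(\Lambda^re^{\tau(t)\Lambda^{1/s}}\theta^\nu-\Lambda^re^{\tau(t)\Lambda^{1/s}}\theta^0\big)(\cdot,t)\big\|_{L^2}=0 .$$ -/

import Mathlib

open Filter Topology MeasureTheory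
open scoped ENNReal ContDiff

noncomputable section

namespace ActiveScalar

/-- A function on `𝕋^d = [0,2π]^d` is a function on `ℝ^d` that is `2π`-periodic in each
coordinate. -/
def IsPeriodic {d : ℕ} (f : (Fin d → ℝ) → ℝ) : Prop :=
  ∀ (i : Fin d) (x : Fin d → ℝ), f (x + Pi.single i (2 * Real.pi)) = f x

/-- The period cell `[0,2π]^d`. -/
def cell (d : ℕ) : Set (Fin d → ℝ) :=
  Set.Icc (fun _ => 0) (fun _ => 2 * Real.pi)

/-- The phase `k · x` for a frequency `k ∈ ℤ^d`. -/
def phase {d : ℕ} (k : Fin d → ℤ) (x : Fin d → ℝ) : ℝ :=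
  ∑ i, (k i : ℝ) * x i

/-- The Euclidean length `|k|` of a frequency `k ∈ ℤ^d`. -/
def freqNorm {d : ℕ} (k : Fin d → ℤ) : ℝ :=
  Real.sqrt (∑ i, (k i : ℝ) ^ 2)

/-- Fourier coefficient `f̂(k) = (2π)^{-d} ∫_{[0,2π]^d} f(x) e^{-i k·x} dx`. -/
def fourierCoefficient {d : ℕ} (f : (Fin d → ℝ) → ℝ) (k : Fin d → ℤ) : ℂ :=
  ((2 * Real.pi : ℝ) : ℂ)⁻¹ ^ d *
    ∫ x in cell d, (f x : ℂ) * Complex.exp (-(Complex.I * (phase k x : ℂ)))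

/-- The partial derivative `∂f/∂x_i`. -/
def partialDeriv {d : ℕ} (i : Fin d) (f : (Fin d → ℝ) → ℝ) (x : Fin d → ℝ) : ℝ :=
  fderiv ℝ f x (Pi.single i 1)

/-- The Fourier multiplier operator with symbol `m`:
`f ↦ ∑_k m(k) f̂(k) e^{i k·x}`. For a symbol with `m(-k) = conj (m(k))` and a real `f` the sum
is real, so that taking the real part only changes the type of the value. -/
def multiplier {d : ℕ} (m : (Fin d → ℤ) → ℂ) (f : (Fin d → ℝ) → ℝ) (x : Fin d → ℝ) : ℝ :=
  (∑' k : Fin d → ℤ,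
    m k * fourierCoefficient f k * Complex.exp (Complex.I * (phase k x : ℂ))).re

/-- The matrices of symbols `T̂^ν_{ij}(k)`, written `T ν i j k`. -/
abbrev SymbolFamily (d : ℕ) : Type :=
  ℝ → Fin d → Fin d → (Fin d → ℤ) → ℂ

/-- The operators `T^ν_{ij}`, `ν ≥ 0`, map real functions to real functions. -/
def IsRealFamily {d : ℕ} (T : SymbolFamily d) : Prop :=
  ∀ ν : ℝ, 0 ≤ ν → ∀ (i j : Fin d) (k : Fin d → ℤ),
    T ν i j (-k) = (starRingEnd ℂ) (T ν i j k)

/-- (A1): `∂_i ∂_j T^ν_{ij} f = 0` (summed over `i, j`) for all `ν ≥ 0` and smooth `f`. -/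
def CondA1 {d : ℕ} (T : SymbolFamily d) : Prop :=
  ∀ ν : ℝ, 0 ≤ ν → ∀ f : (Fin d → ℝ) → ℝ, IsPeriodic f → ContDiff ℝ ∞ f →
    ∀ x, ∑ i, ∑ j, partialDeriv i (partialDeriv j (multiplier (T ν i j) f)) x = 0

/-- (A2): the symbols are bounded, uniformly in `ν ∈ (0,1]` and for `ν = 0`. -/
def CondA2 {d : ℕ} (T : SymbolFamily d) : Prop :=
  ∃ C : ℝ, 0 < C ∧ ∀ (i j : Fin d) (k : Fin d → ℤ),
    (∀ ν : ℝ, 0 < ν → ν ≤ 1 → ‖T ν i j k‖ ≤ C) ∧ ‖T 0 i j k‖ ≤ C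

/-- (A5): `∑_k |T̂^ν_{ij}(k) - T̂^0_{ij}(k)|² |ĝ(k)|² → 0` as `ν → 0⁺`, for all `g ∈ L²`. -/
def CondA5 {d : ℕ} (T : SymbolFamily d) : Prop :=
  ∀ (i j : Fin d) (g : (Fin d → ℝ) → ℝ), MemLp g 2 (volume.restrict (cell d)) →
    Tendsto (fun ν : ℝ => ∑' k : Fin d → ℤ,
        ENNReal.ofReal (‖T ν i j k - T 0 i j k‖ ^ 2 * ‖fourierCoefficient g k‖ ^ 2))
      (𝓝[>] 0) (𝓝 0)

/-- The velocity `u_j[f] = ∂_i T^ν_{ij}[f]` (summed over `i`). -/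
def velocity {d : ℕ} (T : SymbolFamily d) (ν : ℝ) (f : (Fin d → ℝ) → ℝ) (j : Fin d)
    (x : Fin d → ℝ) : ℝ :=
  ∑ i, partialDeriv i (multiplier (T ν i j) f) x

/-- The norm `‖Λ^r e^{τ Λ^{1/s}} f‖_{L²}`, that is, the square root of
`∑_{k ≠ 0} |k|^{2r} e^{2 τ |k|^{1/s}} |f̂(k)|²`, with value `∞` when the sum diverges. -/
def gevreyNorm {d : ℕ} (s r τ : ℝ) (f : (Fin d → ℝ) → ℝ) : ℝ≥0∞ :=
  (∑' k : {k : Fin d → ℤ // k ≠ 0},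
    ENNReal.ofReal (freqNorm k.1 ^ (2 * r) * Real.exp (2 * τ * freqNorm k.1 ^ (1 / s)) *
      ‖fourierCoefficient f k.1‖ ^ 2)) ^ (1 / 2 : ℝ)

/-- Zero mean over the torus. -/
def HasZeroMean {d : ℕ} (f : (Fin d → ℝ) → ℝ) : Prop :=
  ∫ x in cell d, f x = 0

/-- `f` is a (smooth, periodic) function of Gevrey class `s` with radius of convergence at least
`τ`, measured in the norm with `r` additional derivatives. -/
structure IsGevrey {d : ℕ} (s r τ : ℝ) (f : (Fin d → ℝ) → ℝ) : Prop where
  periodic : IsPeriodic f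
  smooth : ContDiff ℝ ∞ f
  norm_lt_top : gevreyNorm s r τ f < ⊤

/-- `θ` is a Gevrey-class `s` solution of
`∂_t θ + u · ∇θ = S`, `u_j = ∂_i T^ν_{ij}[θ]`, `θ(·,0) = θ₀` on `𝕋^d × [0,Tbar]`
with radius of convergence at least `τbar`: the equation holds at every point (with one-sided time
derivatives at the ends of the interval), and the Gevrey norm with radius `τbar` is finite,
uniformly in time. -/
structure IsGevreySolution {d : ℕ} (T : SymbolFamily d) (ν s r τbar Tbar : ℝ)
    (S θ₀ : (Fin d → ℝ) → ℝ) (θ : ℝ → (Fin d → ℝ) → ℝ) : Prop where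
  gevrey : ∀ t ∈ Set.Icc 0 Tbar, IsGevrey s r τbar (θ t)
  bounded : ∃ B : ℝ, ∀ t ∈ Set.Icc 0 Tbar, gevreyNorm s r τbar (θ t) ≤ ENNReal.ofReal B
  initial : ∀ x, θ 0 x = θ₀ x
  equation : ∀ t ∈ Set.Icc 0 Tbar, ∀ x,
    HasDerivWithinAt (fun t' => θ t' x)
      (S x - ∑ j, velocity T ν (θ t) j x * partialDeriv j (θ t) x) (Set.Icc 0 Tbar) t

end ActiveScalar

end

/-! The argument is a compactness argument on Fourier modes.

A Gevrey bound with radius `τbar` forces `|θ̂(k,t)| ≤ B e^{-τbar |k|^{1/s}}` for every `k ≠ 0`,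
uniformly in `ν` and `t` (`norm_le_gevreyDecay`). On the Fourier side the equation reads `a_k' =
Ŝ(k) + Q_k(a)`, where `Q_k` is a convolution whose symbol is bounded by a constant times `|l| |k -
l|` thanks to (A2). The decay beats every polynomial, so these series are dominated by one fixed
summable family. The zero mode, invisible to the norm, is harmless: the factors `|l|` and `|k - l|`
remove it from `Q_k`.

Consequently each mode is Lipschitz in time with a constant independent of `ν`, and Arzelà–Ascoli
gives a uniform limit of each mode along any ultrafilter tending to `0⁺`. (A5), tested on a single
cosine, gives pointwise convergence of the symbols (`CondA5.tendsto_symbol`), and dominated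
convergence shows that the limiting modes solve the limit system (`exists_tendsto_isModeSolution`).

It remains to identify the limit with the modes of `θ 0`. For `s > 1` the limiting modes are summed
back to a classical Gevrey solution (`IsModeSolution.isGevreySolution`) and the assumed uniqueness
applies. For `s = 1` uniqueness on a short time interval is proved by an estimate of
Cauchy–Kovalevskaya type (`exists_time_eq_of_isModeSolution`): the nonlinearity loses one
derivative, and an analyticity radius that shrinks linearly in time gains it back after integration
in time.

All ultrafilter limits agree, so every nonzero mode converges. The uniform bound with radius `τbar`
dominates the norm with radius `τbar / 2`, and modewise convergence becomes convergence in that norm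
(`tendsto_gevreySeqNorm_half`). The radius function can therefore be taken constant. -/

noncomputable section

namespace ActiveScalar

/-! ### Frequencies and characters -/

section Frequencies

variable {d : ℕ}

lemma freqNorm_nonneg (k : Fin d → ℤ) : 0 ≤ freqNorm k := Real.sqrt_nonneg _

lemma freqNorm_eq_norm (k : Fin d → ℤ) :
    freqNorm k = ‖WithLp.toLp 2 (fun i => (k i : ℝ))‖ := by
  simp [freqNorm, EuclideanSpace.norm_eq]

lemma freqNorm_add_le (k l : Fin d → ℤ) : freqNorm (k + l) ≤ freqNorm k + freqNorm l := by
  simp only [freqNorm_eq_norm]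
  refine le_trans (le_of_eq ?_) (norm_add_le _ _)
  congr 1
  ext i
  simp

lemma freqNorm_zero : freqNorm (0 : Fin d → ℤ) = 0 := by
  simp [freqNorm]

lemma abs_apply_le_freqNorm (k : Fin d → ℤ) (i : Fin d) : |(k i : ℝ)| ≤ freqNorm k := by
  rw [freqNorm, ← Real.sqrt_sq_eq_abs]
  exact Real.sqrt_le_sqrt
    (Finset.single_le_sum (f := fun i => (k i : ℝ) ^ 2) (fun i _ => sq_nonneg _)
      (Finset.mem_univ i))

lemma one_le_freqNorm {k : Fin d → ℤ} (hk : k ≠ 0) : 1 ≤ freqNorm k := by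
  obtain ⟨i, hi⟩ := Function.ne_iff.mp hk
  refine le_trans ?_ (abs_apply_le_freqNorm k i)
  exact_mod_cast Int.one_le_abs hi

lemma phase_add_left (k l : Fin d → ℤ) (x : Fin d → ℝ) :
    phase (k + l) x = phase k x + phase l x := by
  simp [phase, add_mul, Finset.sum_add_distrib]

lemma phase_neg_left (k : Fin d → ℤ) (x : Fin d → ℝ) : phase (-k) x = -phase k x := by
  simp [phase]

lemma phase_add_right (k : Fin d → ℤ) (x y : Fin d → ℝ) :
    phase k (x + y) = phase k x + phase k y := by
  simp [phase, mul_add, Finset.sum_add_distrib]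

lemma phase_single (k : Fin d → ℤ) (i : Fin d) (a : ℝ) :
    phase k (Pi.single i a) = k i * a := by
  simp [phase, Pi.single_apply]

/-- The character `x ↦ e^{i k·x}`. -/
def character (k : Fin d → ℤ) (x : Fin d → ℝ) : ℂ :=
  Complex.exp (Complex.I * (phase k x : ℂ))

lemma norm_character (k : Fin d → ℤ) (x : Fin d → ℝ) : ‖character k x‖ = 1 := by
  rw [character, mul_comm]
  exact Complex.norm_exp_ofReal_mul_I _

lemma character_add (k l : Fin d → ℤ) (x : Fin d → ℝ) :
    character (k + l) x = character k x * character l x := by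
  rw [character, phase_add_left, character, character, ← Complex.exp_add]
  push_cast
  ring_nf

lemma character_neg (k : Fin d → ℤ) (x : Fin d → ℝ) :
    character (-k) x = (starRingEnd ℂ) (character k x) := by
  rw [character, character, ← Complex.exp_conj, phase_neg_left]
  simp

/-- The phase as a continuous linear functional. -/
def phaseCLM (k : Fin d → ℤ) : (Fin d → ℝ) →L[ℝ] ℝ :=
  ∑ i, (k i : ℝ) • ContinuousLinearMap.proj i

lemma phaseCLM_apply (k : Fin d → ℤ) (x : Fin d → ℝ) : phaseCLM k x = phase k x := by
  simp [phaseCLM, phase]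

lemma hasFDerivAt_phase (k : Fin d → ℤ) (x : Fin d → ℝ) :
    HasFDerivAt (phase k) (phaseCLM k) x := by
  have h : phase k = phaseCLM k := funext fun y => (phaseCLM_apply k y).symm
  rw [h]
  exact (phaseCLM k).hasFDerivAt

lemma continuous_phase (k : Fin d → ℤ) : Continuous (phase k) := by
  unfold phase
  fun_prop

lemma continuous_character (k : Fin d → ℤ) : Continuous (character k) := by
  have := continuous_phase k
  unfold character
  fun_prop

lemma hasFDerivAt_character (k : Fin d → ℤ) (x : Fin d → ℝ) :
    HasFDerivAt (character k)
      (character k x • Complex.I • Complex.ofRealCLM.comp (phaseCLM k)) x :=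
  ((Complex.ofRealCLM.hasFDerivAt.comp x (hasFDerivAt_phase k x)).const_mul Complex.I).cexp

lemma character_periodic (k : Fin d → ℤ) (i : Fin d) (x : Fin d → ℝ) :
    character k (x + Pi.single i (2 * Real.pi)) = character k x := by
  rw [character, phase_add_right, phase_single, character]
  rw [Complex.exp_eq_exp_iff_exists_int]
  refine ⟨k i, ?_⟩
  push_cast
  ring

lemma measure_cell_lt_top : volume (cell d) < ⊤ := isCompact_Icc.measure_lt_top

lemma fourierCoefficient_eq (f : (Fin d → ℝ) → ℝ) (k : Fin d → ℤ) :
    fourierCoefficient f k =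
      ((2 * Real.pi : ℝ) : ℂ)⁻¹ ^ d * ∫ x in cell d, (f x : ℂ) * character (-k) x := by
  simp [fourierCoefficient, character, phase_neg_left]

/-- Orthogonality of characters: the integral factors over the coordinates, and a coordinate with `k
i ≠ 0` integrates an exponential over full periods. -/
lemma integral_character (k : Fin d → ℤ) :
    ((2 * Real.pi : ℝ) : ℂ)⁻¹ ^ d * ∫ x in cell d, character k x = if k = 0 then 1 else 0 := by
  have hcell : cell d = Set.univ.pi fun _ : Fin d => Set.Icc (0 : ℝ) (2 * Real.pi) := by
    rw [Set.pi_univ_Icc]; rfl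
  have hprod : ∀ x : Fin d → ℝ, character k x = ∏ i, Complex.exp (Complex.I * k i * x i) := by
    intro x
    rw [← Complex.exp_sum, character, phase]
    push_cast
    rw [Finset.mul_sum]
    simp only [mul_assoc]
  have hpi : (2 * Real.pi : ℝ) ≠ 0 := by positivity
  simp_rw [hprod]
  rw [hcell, volume_pi, Measure.restrict_pi_pi,
    integral_fintype_prod_eq_prod (fun (i : Fin d) (y : ℝ) => Complex.exp (Complex.I * k i * y))]
  have h1 : ∀ i, ∫ y in Set.Icc (0 : ℝ) (2 * Real.pi), Complex.exp (Complex.I * k i * y) =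
      if k i = 0 then ((2 * Real.pi : ℝ) : ℂ) else 0 := by
    intro i
    rw [integral_Icc_eq_integral_Ioc, ← intervalIntegral.integral_of_le (by positivity)]
    split_ifs with h
    · simp [h]
    · rw [integral_exp_mul_complex (by simp [h])]
      have : Complex.exp (Complex.I * k i * ((2 * Real.pi : ℝ) : ℂ)) = 1 := by
        rw [Complex.exp_eq_one_iff]
        exact ⟨k i, by push_cast; ring⟩
      rw [this]
      simp
  simp_rw [h1]
  split_ifs with h
  · subst h
    have hpi' : ((2 * Real.pi : ℝ) : ℂ) ≠ 0 := by exact_mod_cast hpi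
    simp only [Pi.zero_apply, if_true, Finset.prod_const, Finset.card_univ, Fintype.card_fin]
    rw [← mul_pow, inv_mul_cancel₀ hpi', one_pow]
  · obtain ⟨i, hi⟩ := Function.ne_iff.mp h
    rw [Finset.prod_eq_zero (Finset.mem_univ i) (by simpa using hi), mul_zero]

end Frequencies

/-! ### Absolutely convergent Fourier series -/

section Series

variable {d : ℕ}

/-- The Fourier series `∑_k c(k) e^{i k·x}`. -/
def fourierSeries (c : (Fin d → ℤ) → ℂ) (x : Fin d → ℝ) : ℂ :=
  ∑' k, c k * character k x

lemma norm_mul_character (c : (Fin d → ℤ) → ℂ) (k : Fin d → ℤ) (x : Fin d → ℝ) :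
    ‖c k * character k x‖ = ‖c k‖ := by
  rw [norm_mul, norm_character, mul_one]

lemma summable_mul_character {c : (Fin d → ℤ) → ℂ} (hc : Summable fun k => ‖c k‖)
    (x : Fin d → ℝ) : Summable fun k => c k * character k x :=
  .of_norm (by simpa only [norm_mul_character] using hc)

lemma continuous_fourierSeries {c : (Fin d → ℤ) → ℂ} (hc : Summable fun k => ‖c k‖) :
    Continuous (fourierSeries c) :=
  continuous_tsum (fun k => continuous_const.mul (continuous_character k)) hc
    fun k x => (norm_mul_character c k x).le

lemma norm_fourierSeries_le {c : (Fin d → ℤ) → ℂ} (hc : Summable fun k => ‖c k‖)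
    (x : Fin d → ℝ) : ‖fourierSeries c x‖ ≤ ∑' k, ‖c k‖ := by
  refine (norm_tsum_le_tsum_norm (by simpa only [norm_mul_character] using hc)).trans ?_
  simp only [norm_mul_character, le_refl]

lemma fourierSeries_periodic (c : (Fin d → ℤ) → ℂ) (i : Fin d) (x : Fin d → ℝ) :
    fourierSeries c (x + Pi.single i (2 * Real.pi)) = fourierSeries c x := by
  simp only [fourierSeries, character_periodic]

lemma fourierSeries_conj {c : (Fin d → ℤ) → ℂ}
    (hc : ∀ k, c (-k) = (starRingEnd ℂ) (c k)) (x : Fin d → ℝ) :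
    (((fourierSeries c x).re : ℝ) : ℂ) = fourierSeries c x := by
  apply Complex.conj_eq_iff_re.mp
  rw [fourierSeries, Complex.conj_tsum, ← (Equiv.neg (Fin d → ℤ)).tsum_eq]
  refine tsum_congr fun k => ?_
  simp [hc, character_neg]

lemma fourierSeries_add {a b : (Fin d → ℤ) → ℂ} (ha : Summable fun k => ‖a k‖)
    (hb : Summable fun k => ‖b k‖) (x : Fin d → ℝ) :
    fourierSeries (fun k => a k + b k) x = fourierSeries a x + fourierSeries b x := by
  simp only [fourierSeries, add_mul]
  exact (summable_mul_character ha x).tsum_add (summable_mul_character hb x)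

lemma fourierSeries_neg (a : (Fin d → ℤ) → ℂ) (x : Fin d → ℝ) :
    fourierSeries (fun k => -a k) x = -fourierSeries a x := by
  simp only [fourierSeries, neg_mul, tsum_neg]

lemma fourierSeries_sum {ι : Type*} (s : Finset ι) {a : ι → (Fin d → ℤ) → ℂ}
    (ha : ∀ i ∈ s, Summable fun k => ‖a i k‖) (x : Fin d → ℝ) :
    fourierSeries (fun k => ∑ i ∈ s, a i k) x = ∑ i ∈ s, fourierSeries (a i) x := by
  simp only [fourierSeries, Finset.sum_mul]
  exact Summable.tsum_finsetSum fun i hi => summable_mul_character (ha i hi) x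

/-- The Fourier coefficients of the sum of an absolutely convergent Fourier series. -/
lemma fourierCoefficient_of_eq_fourierSeries {c : (Fin d → ℤ) → ℂ}
    (hc : Summable fun k => ‖c k‖) {f : (Fin d → ℝ) → ℝ}
    (hf : ∀ x, (f x : ℂ) = fourierSeries c x) (k : Fin d → ℤ) :
    fourierCoefficient f k = c k := by
  have hfin : IsFiniteMeasure (volume.restrict (cell d)) :=
    ⟨by simpa using measure_cell_lt_top⟩
  have hterm : ∀ (l : Fin d → ℤ) (x : Fin d → ℝ),
      c l * character l x * character (-k) x = c l * character (l - k) x := by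
    intro l x
    rw [mul_assoc, ← character_add, sub_eq_add_neg]
  have hint : ∀ l : Fin d → ℤ,
      Integrable (fun x => c l * character (l - k) x) (volume.restrict (cell d)) := by
    intro l
    refine Integrable.of_bound
      (continuous_const.mul (continuous_character _)).aestronglyMeasurable ‖c l‖ ?_
    exact ae_of_all _ fun x => by rw [norm_mul, norm_character, mul_one]
  have hsum := hasSum_integral_of_summable_integral_norm hint (by
    simp only [norm_mul, norm_character, mul_one, integral_const]
    exact hc.mul_left _)
  have heq : ∀ x, (f x : ℂ) * character (-k) x = ∑' l, c l * character (l - k) x := by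
    intro x
    rw [hf, fourierSeries, ← tsum_mul_right]
    exact tsum_congr fun l => hterm l x
  rw [fourierCoefficient_eq]
  simp_rw [heq]
  rw [← hsum.tsum_eq, ← tsum_mul_left, tsum_eq_single k]
  · rw [integral_const_mul, mul_left_comm, integral_character]
    simp
  · intro l hl
    rw [integral_const_mul, mul_left_comm, integral_character]
    simp [sub_eq_zero, hl]

/-- The convolution of two sequences of Fourier coefficients. -/
def convolution (a b : (Fin d → ℤ) → ℂ) (k : Fin d → ℤ) : ℂ := ∑' l, a l * b (k - l)

/-- The bijection `(k, l) ↦ (l, k - l)`. -/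
def convolutionEquiv (d : ℕ) : (Fin d → ℤ) × (Fin d → ℤ) ≃ (Fin d → ℤ) × (Fin d → ℤ) where
  toFun p := (p.2, p.1 - p.2)
  invFun q := (q.1 + q.2, q.1)
  left_inv p := by ext <;> simp
  right_inv q := by ext <;> simp

/-- Reindexing by `(k, l) ↦ (l, k - l)` reduces this to the product family `a p * b q`. The ring is
general because the real majorants need the same fact as the complex coefficients. -/
lemma summable_convolution_prod {R : Type*} [NormedRing R] {a b : (Fin d → ℤ) → R}
    (ha : Summable fun k => ‖a k‖) (hb : Summable fun k => ‖b k‖) :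
    Summable fun p : (Fin d → ℤ) × (Fin d → ℤ) => ‖a p.2 * b (p.1 - p.2)‖ := by
  have h : Summable fun q : (Fin d → ℤ) × (Fin d → ℤ) => ‖a q.1 * b q.2‖ :=
    Summable.mul_norm ha hb
  have h' := h.comp_injective (convolutionEquiv d).injective
  exact h'.congr fun p => rfl

lemma summable_norm_convolution {a b : (Fin d → ℤ) → ℂ}
    (ha : Summable fun k => ‖a k‖) (hb : Summable fun k => ‖b k‖) :
    Summable fun k => ‖convolution a b k‖ := by
  have h := summable_convolution_prod ha hb
  refine Summable.of_nonneg_of_le (fun k => norm_nonneg _) (fun k => ?_) h.prod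
  exact norm_tsum_le_tsum_norm (h.prod_factor k)

lemma fourierSeries_mul {a b : (Fin d → ℤ) → ℂ}
    (ha : Summable fun k => ‖a k‖) (hb : Summable fun k => ‖b k‖) (x : Fin d → ℝ) :
    fourierSeries a x * fourierSeries b x = fourierSeries (convolution a b) x := by
  have ha' : Summable fun k => ‖a k * character k x‖ := by simpa only [norm_mul_character]
  have hb' : Summable fun k => ‖b k * character k x‖ := by simpa only [norm_mul_character]
  rw [fourierSeries, fourierSeries, tsum_mul_tsum_of_summable_norm ha' hb',
    ← (convolutionEquiv d).tsum_eq]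
  have h : Summable fun p : (Fin d → ℤ) × (Fin d → ℤ) =>
      a (convolutionEquiv d p).1 * character (convolutionEquiv d p).1 x *
        (b (convolutionEquiv d p).2 * character (convolutionEquiv d p).2 x) :=
    (convolutionEquiv d).summable_iff.mpr (ha'.mul_norm hb').of_norm
  rw [h.tsum_prod]
  refine tsum_congr fun k => ?_
  rw [convolution, ← tsum_mul_right]
  refine tsum_congr fun l => ?_
  have : character k x = character l x * character (k - l) x := by
    rw [← character_add, add_sub_cancel]
  simp only [convolutionEquiv, Equiv.coe_fn_mk]
  rw [this]
  ring

end Series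

/-! ### Rapidly decaying coefficients -/

section RapidDecay

variable {d : ℕ}

/-- All polynomial moments of the sequence converge absolutely. -/
def RapidDecay {E : Type*} [Norm E] (c : (Fin d → ℤ) → E) : Prop :=
  ∀ n : ℕ, Summable fun k => freqNorm k ^ n * ‖c k‖

lemma RapidDecay.summable {E : Type*} [Norm E] {c : (Fin d → ℤ) → E} (hc : RapidDecay c) :
    Summable fun k => ‖c k‖ := by simpa using hc 0

lemma RapidDecay.of_le {E F : Type*} [NormedAddCommGroup E] [NormedAddCommGroup F]
    {c : (Fin d → ℤ) → E} {b : (Fin d → ℤ) → F} (hc : RapidDecay c)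
    (B : ℝ) (p : ℕ) (h : ∀ k, ‖b k‖ ≤ B * freqNorm k ^ p * ‖c k‖) : RapidDecay b := by
  intro n
  refine Summable.of_nonneg_of_le
    (fun k => mul_nonneg (pow_nonneg (freqNorm_nonneg k) n) (norm_nonneg _)) (fun k => ?_)
    ((hc (n + p)).mul_left B)
  refine (mul_le_mul_of_nonneg_left (h k) (pow_nonneg (freqNorm_nonneg k) n)).trans (le_of_eq ?_)
  rw [pow_add]
  ring

/-- The coefficients of the partial derivative `∂_j` of a Fourier series. -/
def derivCoeff (j : Fin d) (c : (Fin d → ℤ) → ℂ) (k : Fin d → ℤ) : ℂ :=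
  Complex.I * (k j : ℂ) * c k

lemma norm_derivCoeff_le (j : Fin d) (c : (Fin d → ℤ) → ℂ) (k : Fin d → ℤ) :
    ‖derivCoeff j c k‖ ≤ freqNorm k * ‖c k‖ := by
  rw [derivCoeff, norm_mul, norm_mul, Complex.norm_I, one_mul]
  refine mul_le_mul_of_nonneg_right ?_ (norm_nonneg _)
  rw [Complex.norm_intCast]
  exact abs_apply_le_freqNorm k j

lemma RapidDecay.derivCoeff {c : (Fin d → ℤ) → ℂ} (hc : RapidDecay c) (j : Fin d) :
    RapidDecay (derivCoeff j c) :=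
  hc.of_le 1 1 fun k => by simpa using norm_derivCoeff_le j c k

lemma derivCoeff_conj {c : (Fin d → ℤ) → ℂ} (hc : ∀ k, c (-k) = (starRingEnd ℂ) (c k))
    (j : Fin d) (k : Fin d → ℤ) :
    derivCoeff j c (-k) = (starRingEnd ℂ) (derivCoeff j c k) := by
  simp [derivCoeff, hc]

/-- Termwise differentiation, dominated by the first moment of `c`. The factor `d` in the bound
comes from the sup norm on `Fin d → ℝ`. -/
lemma exists_hasFDerivAt_fourierSeries {c : (Fin d → ℤ) → ℂ} (hc : RapidDecay c)
    (x : Fin d → ℝ) :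
    ∃ L : (Fin d → ℝ) →L[ℝ] ℂ, HasFDerivAt (fourierSeries c) L x ∧
      ∀ y, L y = ∑ j, (y j : ℂ) * fourierSeries (derivCoeff j c) x := by
  have hnorm : ∀ (k : Fin d → ℤ) (x : Fin d → ℝ),
      ‖c k • character k x • Complex.I • Complex.ofRealCLM.comp (phaseCLM k)‖ ≤
        d * (freqNorm k * ‖c k‖) := by
    intro k x
    refine ContinuousLinearMap.opNorm_le_bound _ (by have := freqNorm_nonneg k; positivity) ?_
    intro y
    simp only [smul_apply, ContinuousLinearMap.comp_apply, norm_smul,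
      norm_character, Complex.norm_I, one_mul, phaseCLM_apply, Complex.ofRealCLM_apply,
      Complex.norm_real]
    have h : ‖phase k y‖ ≤ d * freqNorm k * ‖y‖ := by
      rw [phase]
      refine (norm_sum_le _ _).trans ?_
      calc ∑ i, ‖(k i : ℝ) * y i‖ ≤ ∑ _i : Fin d, freqNorm k * ‖y‖ := by
            refine Finset.sum_le_sum fun i _ => ?_
            rw [norm_mul]
            exact mul_le_mul (abs_apply_le_freqNorm k i) (norm_le_pi_norm y i) (norm_nonneg _)
              (freqNorm_nonneg k)
        _ = d * freqNorm k * ‖y‖ := by simp [mul_assoc]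
    calc ‖c k‖ * ‖phase k y‖ ≤ ‖c k‖ * (d * freqNorm k * ‖y‖) := by gcongr
      _ = d * (freqNorm k * ‖c k‖) * ‖y‖ := by ring
  have hsum : Summable fun k : Fin d → ℤ => (d : ℝ) * (freqNorm k * ‖c k‖) :=
    Summable.mul_left _ (by simpa using hc 1)
  have hderiv := hasFDerivAt_tsum (x₀ := x) hsum
    (fun k y => (hasFDerivAt_character k y).const_smul (c k)) hnorm
    (by simpa using summable_mul_character hc.summable x) x
  refine ⟨_, hderiv, fun y => ?_⟩
  have hs : Summable fun k =>
      c k • character k x • Complex.I • Complex.ofRealCLM.comp (phaseCLM k) :=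
    .of_norm_bounded hsum fun k => hnorm k x
  have happ := (ContinuousLinearMap.apply ℝ ℂ y).map_tsum hs
  simp only [ContinuousLinearMap.apply_apply] at happ
  rw [happ]
  simp only [fourierSeries, ← tsum_mul_left]
  rw [← Summable.tsum_finsetSum fun j _ =>
    (summable_mul_character (hc.derivCoeff j).summable x).mul_left _]
  refine tsum_congr fun k => ?_
  simp only [smul_apply, ContinuousLinearMap.comp_apply, phaseCLM_apply,
    Complex.ofRealCLM_apply, smul_eq_mul, derivCoeff, phase]
  push_cast
  simp only [Finset.mul_sum]
  exact Finset.sum_congr rfl fun j _ => by ring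

lemma contDiff_fourierSeries {c : (Fin d → ℤ) → ℂ} (hc : RapidDecay c) :
    ContDiff ℝ ∞ (fourierSeries c) := by
  rw [contDiff_infty]
  intro n
  induction n generalizing c with
  | zero => exact contDiff_zero.mpr (continuous_fourierSeries hc.summable)
  | succ n ih =>
    rw [Nat.cast_add, Nat.cast_one, contDiff_succ_iff_fderiv_apply]
    refine ⟨fun x => (exists_hasFDerivAt_fourierSeries hc x).choose_spec.1.differentiableAt,
      -- This component concerns the exponent `ω` (analyticity), which a natural number never
      -- equals.
      fun h => absurd h (by simp), fun y => ?_⟩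
    have heq : (fun x => fderiv ℝ (fourierSeries c) x y) =
        fun x => ∑ j, (y j : ℂ) * fourierSeries (derivCoeff j c) x := by
      funext x
      obtain ⟨L, hL, hLy⟩ := exists_hasFDerivAt_fourierSeries hc x
      rw [hL.fderiv, hLy]
    rw [heq]
    exact ContDiff.sum fun j _ => contDiff_const.mul (ih (hc.derivCoeff j))

lemma partialDeriv_re_fourierSeries {c : (Fin d → ℤ) → ℂ} (hc : RapidDecay c) (j : Fin d)
    (x : Fin d → ℝ) :
    partialDeriv j (fun x => (fourierSeries c x).re) x =
      (fourierSeries (derivCoeff j c) x).re := by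
  obtain ⟨L, hL, hLy⟩ := exists_hasFDerivAt_fourierSeries hc x
  have h : HasFDerivAt (fun x => (fourierSeries c x).re) (Complex.reCLM.comp L) x :=
    Complex.reCLM.hasFDerivAt.comp x hL
  rw [partialDeriv, h.fderiv, ContinuousLinearMap.comp_apply, hLy]
  simp [Pi.single_apply, Finset.sum_ite_eq']

lemma contDiff_re_fourierSeries {c : (Fin d → ℤ) → ℂ} (hc : RapidDecay c) :
    ContDiff ℝ ∞ fun x => (fourierSeries c x).re :=
  Complex.reCLM.contDiff.comp (contDiff_fourierSeries hc)

end RapidDecay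

/-! ### Fourier inversion for periodic functions -/

section Inversion

variable {d : ℕ}

lemma IsPeriodic.add_int {f : (Fin d → ℝ) → ℝ} (hf : IsPeriodic f) (n : Fin d → ℤ)
    (x : Fin d → ℝ) : f (x + fun i => 2 * Real.pi * n i) = f x := by
  have hint : ∀ (i : Fin d) (m : ℤ) (x : Fin d → ℝ),
      f (x + Pi.single i (2 * Real.pi * m)) = f x := by
    intro i m x
    have hp : Function.Periodic (fun s : ℝ => f (x + Pi.single i s)) (2 * Real.pi) := by
      intro s
      simp only [Pi.single_add]
      rw [← add_assoc, hf]
    have := hp.int_mul m 0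
    simpa [mul_comm] using this
  have hfin : ∀ s : Finset (Fin d),
      f (x + ∑ i ∈ s, Pi.single i (2 * Real.pi * n i)) = f x := by
    intro s
    induction s using Finset.induction_on with
    | empty => simp
    | insert i s hi ih => rw [Finset.sum_insert hi, add_comm (Pi.single _ _), ← add_assoc, hint, ih]
  have := hfin Finset.univ
  rwa [Finset.univ_sum_single] at this

/-- The function on the torus `(ℝ/ℤ)^d` induced by a `2π`-periodic function. -/
def torusLift (f : (Fin d → ℝ) → ℝ) (y : UnitAddTorus (Fin d)) : ℂ :=
  f fun i => 2 * Real.pi * (AddCircle.equivIoc (1 : ℝ) 0 (y i) : ℝ)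

lemma torusLift_coe {f : (Fin d → ℝ) → ℝ} (hf : IsPeriodic f) (x : Fin d → ℝ) :
    torusLift f (fun i => (x i : AddCircle (1 : ℝ))) = f fun i => 2 * Real.pi * x i := by
  have h : ∀ i, ∃ n : ℤ,
      (AddCircle.equivIoc (1 : ℝ) 0 (x i : AddCircle (1 : ℝ)) : ℝ) = x i + n := by
    intro i
    have h1 : ((AddCircle.equivIoc (1 : ℝ) 0 (x i : AddCircle (1 : ℝ)) : ℝ) : AddCircle (1 : ℝ)) =
        (x i : AddCircle (1 : ℝ)) :=
      (AddCircle.equivIoc (1 : ℝ) 0).symm_apply_apply (x i : AddCircle (1 : ℝ))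
    rw [← sub_eq_zero, ← AddCircle.coe_sub, AddCircle.coe_eq_zero_iff] at h1
    obtain ⟨n, hn⟩ := h1
    exact ⟨n, by rw [zsmul_one] at hn; linarith⟩
  choose n hn using h
  simp only [torusLift, hn]
  rw [← hf.add_int n fun i => 2 * Real.pi * x i]
  congr 2
  funext i
  simp [mul_add]

/-- The representative chosen in `(0,1]` jumps, so continuity is checked after composing with the
quotient map, where periodicity removes the choice. -/
lemma continuous_torusLift {f : (Fin d → ℝ) → ℝ} (hf : IsPeriodic f) (hc : Continuous f) :
    Continuous (torusLift f) := by
  have hq : IsOpenQuotientMap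
      (fun (x : Fin d → ℝ) (i : Fin d) => (x i : AddCircle (1 : ℝ))) :=
    IsOpenQuotientMap.piMap fun _ => QuotientAddGroup.isOpenQuotientMap_mk
  rw [hq.isQuotientMap.continuous_iff]
  have : torusLift f ∘ (fun (x : Fin d → ℝ) (i : Fin d) => (x i : AddCircle (1 : ℝ))) =
      fun x => (f fun i => 2 * Real.pi * x i : ℂ) := funext fun x => torusLift_coe hf x
  rw [this]
  fun_prop

lemma mFourier_coe (k : Fin d → ℤ) (x : Fin d → ℝ) :
    UnitAddTorus.mFourier k (fun i => (x i : AddCircle (1 : ℝ))) =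
      character k fun i => 2 * Real.pi * x i := by
  simp only [UnitAddTorus.mFourier, ContinuousMap.coe_mk, fourier_coe_apply, character, phase,
    ← Complex.exp_sum]
  push_cast
  rw [Finset.mul_sum]
  congr 1
  exact Finset.sum_congr rfl fun i _ => by simp; ring

/-- Scaling by `2π` carries the unit cell to `cell d`; the Jacobian is the normalisation
`(2π)^{-d}`. Half-open and closed cells differ by a null set. -/
lemma mFourierCoeff_torusLift {f : (Fin d → ℝ) → ℝ} (hf : IsPeriodic f) (k : Fin d → ℤ) :
    UnitAddTorus.mFourierCoeff (torusLift f) k = fourierCoefficient f k := by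
  rw [UnitAddTorus.mFourierCoeff_eq_integral _ _ 0, fourierCoefficient_eq]
  simp only [torusLift_coe hf, mFourier_coe, smul_eq_mul, Pi.zero_apply, zero_add]
  have hpi : (0 : ℝ) < 2 * Real.pi := by positivity
  have hset : {x : Fin d → ℝ | ∀ i, x i ∈ Set.Ioc (0 : ℝ) 1} =
      (fun x => (2 * Real.pi) • x) ⁻¹' Set.univ.pi fun _ => Set.Ioc 0 (2 * Real.pi) := by
    ext x
    simp only [Set.mem_ofPred_eq, Set.mem_preimage, Set.mem_univ_pi, Pi.smul_apply, smul_eq_mul,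
      Set.mem_Ioc]
    refine forall_congr' fun i => and_congr ?_ ?_
    · rw [mul_pos_iff_of_pos_left hpi]
    · rw [mul_le_iff_le_one_right hpi]
  have hIoc : (Set.univ.pi fun _ : Fin d => Set.Ioc (0 : ℝ) (2 * Real.pi)) =ᵐ[volume] cell d :=
    Measure.univ_pi_Ioc_ae_eq_Icc
  rw [← setIntegral_congr_set hIoc, hset]
  set A := Set.univ.pi fun _ : Fin d => Set.Ioc (0 : ℝ) (2 * Real.pi) with hA
  have hAm : MeasurableSet A := MeasurableSet.univ_pi fun _ => measurableSet_Ioc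
  have key := Measure.integral_comp_smul (volume : Measure (Fin d → ℝ))
    (A.indicator fun y => (f y : ℂ) * character (-k) y) (2 * Real.pi)
  rw [integral_indicator hAm] at key
  rw [← integral_indicator (hAm.preimage (by fun_prop))]
  convert key using 1
  · congr 1
    funext x
    by_cases hx : (2 * Real.pi) • x ∈ A
    · rw [Set.indicator_of_mem hx, Set.indicator_of_mem (Set.mem_preimage.mpr hx), mul_comm]
      rfl
    · rw [Set.indicator_of_notMem hx, Set.indicator_of_notMem fun h => hx (Set.mem_preimage.mp h)]
  · rw [Module.finrank_fintype_fun_eq_card, Fintype.card_fin, abs_of_nonneg (by positivity),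
      Complex.real_smul]
    push_cast
    rw [inv_pow]

/-- **Fourier inversion** for continuous periodic functions with summable coefficients. -/
theorem eq_fourierSeries {f : (Fin d → ℝ) → ℝ} (hf : IsPeriodic f) (hc : Continuous f)
    (hs : Summable fun k => ‖fourierCoefficient f k‖) (x : Fin d → ℝ) :
    (f x : ℂ) = fourierSeries (fourierCoefficient f) x := by
  let F : C(UnitAddTorus (Fin d), ℂ) := ⟨torusLift f, continuous_torusLift hf hc⟩
  have hcoef : UnitAddTorus.mFourierCoeff F = fourierCoefficient f :=
    funext fun k => mFourierCoeff_torusLift hf k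
  have h := UnitAddTorus.hasSum_mFourier_series_apply_of_summable (f := F)
    (by rw [hcoef]; exact hs.of_norm) fun i => ((x i / (2 * Real.pi) : ℝ) : AddCircle (1 : ℝ))
  have hpi : (2 * Real.pi : ℝ) ≠ 0 := by positivity
  have hx : (fun i => 2 * Real.pi * (x i / (2 * Real.pi))) = x := by
    funext i
    field_simp
  have hF : F (fun i => ((x i / (2 * Real.pi) : ℝ) : AddCircle (1 : ℝ))) = f x := by
    change torusLift f _ = _
    rw [torusLift_coe hf, hx]
  rw [hF] at h
  simp only [mFourier_coe, hcoef, hx, smul_eq_mul] at h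
  exact h.tsum_eq.symm

lemma fourierCoefficient_neg (f : (Fin d → ℝ) → ℝ) (k : Fin d → ℤ) :
    fourierCoefficient f (-k) = (starRingEnd ℂ) (fourierCoefficient f k) := by
  rw [fourierCoefficient_eq, fourierCoefficient_eq, map_mul, ← integral_conj]
  simp only [map_mul, map_pow, map_inv₀, Complex.conj_ofReal, character_neg,
    Complex.conj_conj, neg_neg]

end Inversion

/-! ### The nonlinearity on the Fourier side -/

section Nonlinearity

variable {d : ℕ}

/-- The bilinear symbol `∑_{ij} l_i n_j m_{ij}(l)`. -/
def bilinearSymbol (m : Fin d → Fin d → (Fin d → ℤ) → ℂ) (l n : Fin d → ℤ) : ℂ :=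
  ∑ j, ∑ i, (l i : ℂ) * (n j : ℂ) * m i j l

lemma norm_bilinearSymbol_le {m : Fin d → Fin d → (Fin d → ℤ) → ℂ} {C : ℝ}
    (hm : ∀ i j k, ‖m i j k‖ ≤ C) (l n : Fin d → ℤ) :
    ‖bilinearSymbol m l n‖ ≤ d ^ 2 * C * (freqNorm l * freqNorm n) := by
  have hl := freqNorm_nonneg l
  have hn := freqNorm_nonneg n
  have h : ∀ i j, ‖(l i : ℂ) * (n j : ℂ) * m i j l‖ ≤ freqNorm l * freqNorm n * C := by
    intro i j
    rw [norm_mul, norm_mul, Complex.norm_intCast, Complex.norm_intCast]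
    have h1 := abs_apply_le_freqNorm l i
    have h2 := abs_apply_le_freqNorm n j
    have h3 := hm i j l
    gcongr
  calc ‖bilinearSymbol m l n‖ ≤ ∑ _j : Fin d, ∑ _i : Fin d, freqNorm l * freqNorm n * C :=
        (norm_sum_le _ _).trans <| Finset.sum_le_sum fun j _ =>
          (norm_sum_le _ _).trans <| Finset.sum_le_sum fun i _ => h i j
    _ = d ^ 2 * C * (freqNorm l * freqNorm n) := by
        simp only [Finset.sum_const, Finset.card_univ, Fintype.card_fin, nsmul_eq_mul]
        ring

/-- The coefficients of `-u·∇f` in terms of the coefficients `a` of `f`. -/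
def quadratic {R : Type*} [NormedRing R] [NormedAlgebra ℂ R]
    (m : Fin d → Fin d → (Fin d → ℤ) → ℂ) (a : (Fin d → ℤ) → R) (k : Fin d → ℤ) : R :=
  ∑' l, bilinearSymbol m l (k - l) • (a l * a (k - l))

/-- A majorant of the coefficients of the nonlinearity. -/
def quadraticMajorant (D : (Fin d → ℤ) → ℝ) (k : Fin d → ℤ) : ℝ :=
  ∑' l, freqNorm l * D l * (freqNorm (k - l) * D (k - l))

lemma summable_quadraticMajorant_prod {D : (Fin d → ℤ) → ℝ} (hD : RapidDecay D) :
    Summable fun p : (Fin d → ℤ) × (Fin d → ℤ) =>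
      freqNorm p.2 * D p.2 * (freqNorm (p.1 - p.2) * D (p.1 - p.2)) := by
  have h : Summable fun k => ‖freqNorm k * D k‖ := by
    simpa [norm_mul, Real.norm_of_nonneg (freqNorm_nonneg _)] using hD 1
  exact (summable_convolution_prod h h).of_norm

lemma summable_quadraticMajorant {D : (Fin d → ℤ) → ℝ} (hD : RapidDecay D) :
    Summable (quadraticMajorant D) :=
  (summable_quadraticMajorant_prod hD).prod

section

variable {R : Type*} [NormedRing R] [NormedAlgebra ℂ R]
  {m : Fin d → Fin d → (Fin d → ℤ) → ℂ} {C : ℝ} {D : (Fin d → ℤ) → ℝ} {a : (Fin d → ℤ) → R}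

/-- A bound on `a` away from frequency zero is enough, because the weights `|l|` and `|k - l|`
vanish there. With `R` general, the estimate covers coefficients at a fixed time and modes in
`C([0,Tbar], ℂ)` alike. -/
lemma norm_quadratic_term_le (hm : ∀ i j k, ‖m i j k‖ ≤ C) (hC : 0 ≤ C)
    (ha : ∀ k, k ≠ 0 → ‖a k‖ ≤ D k) (k l : Fin d → ℤ) :
    ‖bilinearSymbol m l (k - l) • (a l * a (k - l))‖ ≤
      d ^ 2 * C * (freqNorm l * D l * (freqNorm (k - l) * D (k - l))) := by
  have hle : ∀ l, freqNorm l * ‖a l‖ ≤ freqNorm l * D l := by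
    intro l
    rcases eq_or_ne l 0 with rfl | hl
    · simp [freqNorm_zero]
    · exact mul_le_mul_of_nonneg_left (ha l hl) (freqNorm_nonneg l)
  have h0 : ∀ l, 0 ≤ freqNorm l * ‖a l‖ := fun l =>
    mul_nonneg (freqNorm_nonneg l) (norm_nonneg _)
  calc ‖bilinearSymbol m l (k - l) • (a l * a (k - l))‖
      ≤ ‖bilinearSymbol m l (k - l)‖ * (‖a l‖ * ‖a (k - l)‖) := by
        rw [norm_smul]
        exact mul_le_mul_of_nonneg_left (norm_mul_le _ _) (norm_nonneg _)
    _ ≤ d ^ 2 * C * (freqNorm l * freqNorm (k - l)) * (‖a l‖ * ‖a (k - l)‖) :=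
        mul_le_mul_of_nonneg_right (norm_bilinearSymbol_le hm l (k - l)) (by positivity)
    _ = d ^ 2 * C * (freqNorm l * ‖a l‖ * (freqNorm (k - l) * ‖a (k - l)‖)) := by ring
    _ ≤ _ := mul_le_mul_of_nonneg_left
        (mul_le_mul (hle l) (hle (k - l)) (h0 _) ((h0 l).trans (hle l))) (by positivity)

lemma summable_quadratic_term [CompleteSpace R] (hm : ∀ i j k, ‖m i j k‖ ≤ C) (hC : 0 ≤ C)
    (hD : RapidDecay D) (ha : ∀ k, k ≠ 0 → ‖a k‖ ≤ D k) (k : Fin d → ℤ) :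
    Summable fun l => bilinearSymbol m l (k - l) • (a l * a (k - l)) :=
  .of_norm_bounded (((summable_quadraticMajorant_prod hD).prod_factor k).mul_left _)
    fun l => norm_quadratic_term_le hm hC ha k l

lemma norm_quadratic_le (hm : ∀ i j k, ‖m i j k‖ ≤ C) (hC : 0 ≤ C)
    (hD : RapidDecay D) (ha : ∀ k, k ≠ 0 → ‖a k‖ ≤ D k) (k : Fin d → ℤ) :
    ‖quadratic m a k‖ ≤ d ^ 2 * C * quadraticMajorant D k := by
  have hs := ((summable_quadraticMajorant_prod hD).prod_factor k).mul_left ((d : ℝ) ^ 2 * C)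
  refine (tsum_of_norm_bounded hs.hasSum fun l => norm_quadratic_term_le hm hC ha k l).trans ?_
  rw [tsum_mul_left, quadraticMajorant]

end

lemma sum_convolution_derivCoeff {m : Fin d → Fin d → (Fin d → ℤ) → ℂ} {C : ℝ}
    (hm : ∀ i j k, ‖m i j k‖ ≤ C) {a : (Fin d → ℤ) → ℂ} (ha : RapidDecay a) (k : Fin d → ℤ) :
    ∑ j, ∑ i, convolution (derivCoeff i fun l => m i j l * a l) (derivCoeff j a) k =
      -quadratic m a k := by
  have hma : ∀ i j, RapidDecay fun l => m i j l * a l := fun i j =>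
    ha.of_le C 0 fun l => by
      rw [norm_mul, pow_zero, mul_one]
      exact mul_le_mul_of_nonneg_right (hm i j l) (norm_nonneg _)
  have hs : ∀ i j, Summable fun l =>
      derivCoeff i (fun l => m i j l * a l) l * derivCoeff j a (k - l) := fun i j =>
    ((summable_convolution_prod ((hma i j).derivCoeff i).summable
      (ha.derivCoeff j).summable).prod_factor k).of_norm
  simp only [convolution]
  rw [quadratic, ← tsum_neg,
    Finset.sum_congr rfl fun j _ => (Summable.tsum_finsetSum fun i _ => hs i j).symm,
    ← Summable.tsum_finsetSum fun j _ => summable_sum fun i _ => hs i j]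
  refine tsum_congr fun l => ?_
  rw [bilinearSymbol, smul_eq_mul, Finset.sum_mul, ← Finset.sum_neg_distrib]
  refine Finset.sum_congr rfl fun j _ => ?_
  rw [Finset.sum_mul, ← Finset.sum_neg_distrib]
  refine Finset.sum_congr rfl fun i _ => ?_
  simp only [derivCoeff]
  linear_combination (l i : ℂ) * m i j l * a l * ((k - l) j : ℂ) * a (k - l) * Complex.I_mul_I

/-- The transport term `u·∇f` as an absolutely convergent Fourier series. -/
lemma sum_velocity_mul_partialDeriv {T : SymbolFamily d} {ν C : ℝ}
    (hm : ∀ i j k, ‖T ν i j k‖ ≤ C)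
    (hT : ∀ i j k, T ν i j (-k) = (starRingEnd ℂ) (T ν i j k))
    {f : (Fin d → ℝ) → ℝ} (hf : IsPeriodic f) (hc : Continuous f)
    (hr : RapidDecay (fourierCoefficient f)) (x : Fin d → ℝ) :
    ((∑ j, velocity T ν f j x * partialDeriv j f x : ℝ) : ℂ) =
      -fourierSeries (quadratic (T ν) (fourierCoefficient f)) x := by
  set a := fourierCoefficient f with ha
  have hconj : ∀ k, a (-k) = (starRingEnd ℂ) (a k) := fourierCoefficient_neg f
  have hma : ∀ i j, RapidDecay fun l => T ν i j l * a l := fun i j =>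
    hr.of_le C 0 fun l => by
      rw [norm_mul, pow_zero, mul_one]
      exact mul_le_mul_of_nonneg_right (hm i j l) (norm_nonneg _)
  have hfa : f = fun x => (fourierSeries a x).re := by
    funext y
    rw [← eq_fourierSeries hf hc hr.summable y, Complex.ofReal_re]
  have hpd : ∀ j, ((partialDeriv j f x : ℝ) : ℂ) = fourierSeries (derivCoeff j a) x := by
    intro j
    rw [hfa, partialDeriv_re_fourierSeries hr, fourierSeries_conj (derivCoeff_conj hconj j)]
  have hvel : ∀ j, ((velocity T ν f j x : ℝ) : ℂ) =
      ∑ i, fourierSeries (derivCoeff i fun l => T ν i j l * a l) x := by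
    intro j
    rw [velocity, Complex.ofReal_sum]
    refine Finset.sum_congr rfl fun i _ => ?_
    have : multiplier (T ν i j) f = fun x => (fourierSeries (fun l => T ν i j l * a l) x).re := rfl
    rw [this, partialDeriv_re_fourierSeries (hma i j), fourierSeries_conj
      (derivCoeff_conj (fun k => by rw [hT, hconj, map_mul]) i)]
  rw [Complex.ofReal_sum]
  simp only [Complex.ofReal_mul, hpd, hvel, Finset.sum_mul]
  rw [← fourierSeries_neg]
  simp only [← sum_convolution_derivCoeff hm hr]
  have hcs : ∀ i j, Summable fun k =>
      ‖convolution (derivCoeff i fun l => T ν i j l * a l) (derivCoeff j a) k‖ := fun i j =>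
    summable_norm_convolution ((hma i j).derivCoeff i).summable (hr.derivCoeff j).summable
  rw [fourierSeries_sum]
  · refine Finset.sum_congr rfl fun j _ => ?_
    rw [fourierSeries_sum _ fun i _ => hcs i j]
    refine Finset.sum_congr rfl fun i _ => ?_
    rw [fourierSeries_mul ((hma i j).derivCoeff i).summable (hr.derivCoeff j).summable]
  · intro j _
    exact Summable.of_nonneg_of_le (fun k => norm_nonneg _) (fun k => norm_sum_le _ _)
      (summable_sum fun i _ => hcs i j)

end Nonlinearity

/-! ### Time derivatives of coefficients and of series -/

section TimeDerivative

variable {d : ℕ}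

/-- The mean value inequality for difference quotients; it supplies the dominating bound for the two
differentiations under an integral and under a sum that follow. -/
lemma norm_slope_le_of_hasDerivWithinAt {E : Type*} [NormedAddCommGroup E] [NormedSpace ℝ E]
    {f f' : ℝ → E} {s : Set ℝ} (hs : Convex ℝ s) {B : ℝ}
    (hf : ∀ t ∈ s, HasDerivWithinAt f (f' t) s t) (hB : ∀ t ∈ s, ‖f' t‖ ≤ B)
    {t t' : ℝ} (ht : t ∈ s) (ht' : t' ∈ s) (hne : t' ≠ t) : ‖slope f t t'‖ ≤ B := by
  have h := hs.norm_image_sub_le_of_norm_hasDerivWithin_le hf hB ht ht'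
  have hpos : 0 < ‖t' - t‖ := norm_pos_iff.mpr (sub_ne_zero.mpr hne)
  rw [slope_def_module, norm_smul, norm_inv, inv_mul_le_iff₀ hpos, mul_comm]
  exact h

lemma hasDerivWithinAt_fourierCoefficient {θ g : ℝ → (Fin d → ℝ) → ℝ} {s : Set ℝ}
    (hs : Convex ℝ s) {B : ℝ} (hθ : ∀ t ∈ s, Continuous (θ t))
    (hd : ∀ t ∈ s, ∀ x, HasDerivWithinAt (fun t' => θ t' x) (g t x) s t)
    (hB : ∀ t ∈ s, ∀ x, ‖g t x‖ ≤ B) {t : ℝ} (ht : t ∈ s) (k : Fin d → ℤ) :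
    HasDerivWithinAt (fun t' => fourierCoefficient (θ t') k) (fourierCoefficient (g t) k) s t := by
  have hfin : IsFiniteMeasure (volume.restrict (cell d)) :=
    ⟨by simpa using measure_cell_lt_top⟩
  rw [hasDerivWithinAt_iff_tendsto_slope]
  have hint : ∀ t ∈ s, Integrable (fun x => (θ t x : ℂ) * character (-k) x)
      (volume.restrict (cell d)) := by
    intro t ht
    have : Continuous fun x => (θ t x : ℂ) * character (-k) x :=
      (Complex.continuous_ofReal.comp (hθ t ht)).mul (continuous_character _)
    exact this.continuousOn.integrableOn_compact isCompact_Icc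
  have hslope : ∀ t' ∈ s, slope (fun t' => fourierCoefficient (θ t') k) t t' =
      ((2 * Real.pi : ℝ) : ℂ)⁻¹ ^ d *
        ∫ x in cell d, (slope (fun t' => θ t' x) t t' : ℂ) * character (-k) x := by
    intro t' ht'
    simp only [slope_def_module, fourierCoefficient_eq]
    rw [← mul_sub, ← integral_sub (hint t' ht') (hint t ht), ← mul_smul_comm, ← integral_smul]
    congr 2
    funext x
    rw [← sub_mul, Complex.real_smul, smul_eq_mul]
    push_cast
    ring
  have hmem : ∀ᶠ t' in 𝓝[s \ {t}] t, t' ∈ s \ {t} := self_mem_nhdsWithin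
  rw [fourierCoefficient_eq]
  refine Tendsto.congr' (hmem.mono fun t' ht' => (hslope t' ht'.1).symm) ?_
  refine Tendsto.const_mul _ ?_
  refine tendsto_integral_filter_of_dominated_convergence (fun _ => B) ?_ ?_
    (integrable_const _) ?_
  · filter_upwards [hmem] with t' ht'
    have : Continuous fun x => (slope (fun t' => θ t' x) t t' : ℂ) * character (-k) x := by
      simp only [slope_def_module]
      have h1 := hθ t ht
      have h2 := hθ t' ht'.1
      have h3 := continuous_character (-k)
      fun_prop
    exact this.aestronglyMeasurable
  · filter_upwards [hmem] with t' ht'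
    refine ae_of_all _ fun x => ?_
    rw [norm_mul, norm_character, mul_one, Complex.norm_real]
    exact norm_slope_le_of_hasDerivWithinAt hs (fun t ht => hd t ht x) (fun t ht => hB t ht x)
      ht ht'.1 ht'.2
  · refine ae_of_all _ fun x => ?_
    have := hasDerivWithinAt_iff_tendsto_slope.mp (hd t ht x)
    exact ((Complex.continuous_ofReal.tendsto _).comp this).mul_const _

lemma hasDerivWithinAt_fourierSeries {α α' : (Fin d → ℤ) → ℝ → ℂ} {s : Set ℝ}
    (hs : Convex ℝ s) {u : (Fin d → ℤ) → ℝ} (hu : Summable u)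
    (hsum : ∀ t ∈ s, Summable fun k => ‖α k t‖)
    (hd : ∀ k, ∀ t ∈ s, HasDerivWithinAt (α k) (α' k t) s t)
    (hB : ∀ k, ∀ t ∈ s, ‖α' k t‖ ≤ u k) {t : ℝ} (ht : t ∈ s) (x : Fin d → ℝ) :
    HasDerivWithinAt (fun t' => fourierSeries (fun k => α k t') x)
      (fourierSeries (fun k => α' k t) x) s t := by
  rw [hasDerivWithinAt_iff_tendsto_slope]
  have hmem : ∀ᶠ t' in 𝓝[s \ {t}] t, t' ∈ s \ {t} := self_mem_nhdsWithin
  have hslope : ∀ t' ∈ s, slope (fun t' => fourierSeries (fun k => α k t') x) t t' =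
      ∑' k, slope (α k) t t' * character k x := by
    intro t' ht'
    simp only [slope_def_module, fourierSeries]
    rw [← (summable_mul_character (hsum t' ht') x).tsum_sub (summable_mul_character (hsum t ht) x),
      ← tsum_const_smul'']
    exact tsum_congr fun k => by rw [← sub_mul, smul_mul_assoc]
  refine Tendsto.congr' (hmem.mono fun t' ht' => (hslope t' ht'.1).symm) ?_
  refine tendsto_tsum_of_dominated_convergence hu (fun k => ?_) ?_
  · exact (hasDerivWithinAt_iff_tendsto_slope.mp (hd k t ht)).mul_const _
  · filter_upwards [hmem] with t' ht' k
    rw [norm_mul, norm_character, mul_one]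
    exact norm_slope_le_of_hasDerivWithinAt hs (hd k) (hB k) ht ht'.1 ht'.2

end TimeDerivative

/-! ### Gevrey weights -/

section GevreyWeights

variable {d : ℕ}

/-- With `y = x^{1/s}` a power of `x` is at most an integer power of `1 + y`, and `z^p / p! ≤ e^z`
at `z = τ (1 + y)` finishes. The shift from `y` to `1 + y` costs the factor `e^τ`. -/
lemma exists_pow_mul_exp_neg_rpow_le {s τ : ℝ} (hs : 1 ≤ s) (hτ : 0 < τ) (n : ℕ) :
    ∃ B : ℝ, 0 ≤ B ∧ ∀ x : ℝ, 0 ≤ x → (1 + x) ^ n * Real.exp (-(τ * x ^ (1 / s))) ≤ B := by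
  set N := ⌈s⌉₊ with hN
  refine ⟨2 ^ n * (Real.exp τ * ((N * n).factorial / τ ^ (N * n))), by positivity,
    fun x hx => ?_⟩
  set y := x ^ (1 / s) with hy
  have hy0 : 0 ≤ y := Real.rpow_nonneg hx _
  have hxy : x = y ^ s := by
    rw [hy, ← Real.rpow_mul hx, one_div, inv_mul_cancel₀ (by positivity), Real.rpow_one]
  have h1 : x ≤ (1 + y) ^ N := by
    rw [hxy, ← Real.rpow_natCast]
    calc y ^ s ≤ (1 + y) ^ s := Real.rpow_le_rpow hy0 (by linarith) (by linarith)
      _ ≤ (1 + y) ^ (N : ℝ) := Real.rpow_le_rpow_of_exponent_le (by linarith) (Nat.le_ceil s)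
  have h2 : (1 : ℝ) ≤ (1 + y) ^ N := one_le_pow₀ (by linarith)
  have h3 : (1 + x) ^ n ≤ 2 ^ n * (1 + y) ^ (N * n) := by
    rw [pow_mul, ← mul_pow]
    exact pow_le_pow_left₀ (by linarith) (by linarith) n
  have h4 : (1 + y) ^ (N * n) * Real.exp (-(τ * (1 + y))) ≤ (N * n).factorial / τ ^ (N * n) := by
    have := Real.pow_div_factorial_le_exp (τ * (1 + y)) (by positivity) (N * n)
    rw [div_le_iff₀ (by positivity), mul_pow] at this
    rw [le_div_iff₀ (by positivity), Real.exp_neg]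
    have he := Real.exp_pos (τ * (1 + y))
    calc (1 + y) ^ (N * n) * (Real.exp (τ * (1 + y)))⁻¹ * τ ^ (N * n)
        = (τ ^ (N * n) * (1 + y) ^ (N * n)) * (Real.exp (τ * (1 + y)))⁻¹ := by ring
      _ ≤ (Real.exp (τ * (1 + y)) * (N * n).factorial) * (Real.exp (τ * (1 + y)))⁻¹ := by gcongr
      _ = (N * n).factorial := by field_simp
  calc (1 + x) ^ n * Real.exp (-(τ * y))
      ≤ 2 ^ n * (1 + y) ^ (N * n) * Real.exp (-(τ * y)) := by gcongr
    _ = 2 ^ n * (Real.exp τ * ((1 + y) ^ (N * n) * Real.exp (-(τ * (1 + y))))) := by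
        rw [show -(τ * y) = τ + -(τ * (1 + y)) by ring, Real.exp_add]
        ring
    _ ≤ _ := by gcongr

/-- A finite set of frequencies lies in a box, over which the sum of products is a product of
one-dimensional sums. -/
lemma summable_pi_prod {g : ℤ → ℝ} (hg0 : ∀ n, 0 ≤ g n) (hg : Summable g) :
    Summable fun k : Fin d → ℤ => ∏ i, g (k i) := by
  classical
  refine summable_of_sum_le (c := (∑' n, g n) ^ d)
    (fun k => Finset.prod_nonneg fun i _ => hg0 _) fun u => ?_
  have hsub : u ⊆ Fintype.piFinset fun i => u.image fun k => k i := by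
    intro k hk
    rw [Fintype.mem_piFinset]
    exact fun i => Finset.mem_image_of_mem _ hk
  calc ∑ k ∈ u, ∏ i, g (k i)
      ≤ ∑ k ∈ Fintype.piFinset fun i => u.image fun k => k i, ∏ i, g (k i) :=
        Finset.sum_le_sum_of_subset_of_nonneg hsub
          fun k _ _ => Finset.prod_nonneg fun i _ => hg0 _
    _ = ∏ i, ∑ n ∈ u.image fun k => k i, g n := (Finset.prod_univ_sum _ _).symm
    _ ≤ ∏ _i : Fin d, ∑' n, g n :=
        Finset.prod_le_prod (fun i _ => Finset.sum_nonneg fun n _ => hg0 n)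
          fun i _ => hg.sum_le_tsum _ fun n _ => hg0 n
    _ = (∑' n, g n) ^ d := by simp

lemma summable_inv_one_add_freqNorm_pow :
    Summable fun k : Fin d → ℤ => ((1 + freqNorm k) ^ (2 * d))⁻¹ := by
  have hg : Summable fun n : ℤ => ((1 + |(n : ℝ)|) ^ 2)⁻¹ := by
    have h1 : Summable fun n : ℤ => ((n : ℝ) ^ 2)⁻¹ := by
      simpa using Real.summable_one_div_int_pow.mpr (one_lt_two)
    refine Summable.of_norm_bounded_eventually h1 ?_
    filter_upwards [(Set.finite_singleton (0 : ℤ)).compl_mem_cofinite] with n hn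
    have hn' : (n : ℝ) ≠ 0 := by exact_mod_cast hn
    rw [Real.norm_of_nonneg (by positivity)]
    apply inv_anti₀ (by positivity)
    rw [← sq_abs (n : ℝ)]
    gcongr
    linarith
  refine Summable.of_nonneg_of_le (fun k => ?_) (fun k => ?_)
    (summable_pi_prod (d := d) (fun n => by positivity) hg)
  · have := freqNorm_nonneg k
    positivity
  · rw [Finset.prod_inv_distrib]
    have := freqNorm_nonneg k
    apply inv_anti₀ (Finset.prod_pos fun i _ => by positivity)
    calc ∏ i, (1 + |(k i : ℝ)|) ^ 2 ≤ ∏ _i : Fin d, (1 + freqNorm k) ^ 2 := by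
          refine Finset.prod_le_prod (fun i _ => by positivity) fun i _ => ?_
          have := abs_apply_le_freqNorm k i
          gcongr
      _ = (1 + freqNorm k) ^ (2 * d) := by simp [pow_mul]

/-- The decay `B e^{-τ|k|^{1/s}}` of the coefficients of a function of Gevrey class `s`. -/
def gevreyDecay (s τ B : ℝ) (k : Fin d → ℤ) : ℝ :=
  B * Real.exp (-(τ * freqNorm k ^ (1 / s)))

lemma rapidDecay_gevreyDecay {s τ : ℝ} (hs : 1 ≤ s) (hτ : 0 < τ) (B : ℝ) :
    RapidDecay (gevreyDecay (d := d) s τ B) := by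
  intro n
  -- The extra `2 * d` powers leave the summable factor `(1 + |k|)^{-2d}`.
  obtain ⟨A, hA0, hA⟩ := exists_pow_mul_exp_neg_rpow_le hs hτ (n + 2 * d)
  refine Summable.of_nonneg_of_le
    (fun k => mul_nonneg (pow_nonneg (freqNorm_nonneg k) n) (norm_nonneg _)) (fun k => ?_)
    ((summable_inv_one_add_freqNorm_pow (d := d)).mul_left (|B| * A))
  have hk := freqNorm_nonneg k
  have h := hA _ hk
  rw [gevreyDecay, norm_mul, Real.norm_of_nonneg (Real.exp_pos _).le, Real.norm_eq_abs]
  rw [← div_eq_mul_inv, le_div_iff₀ (by positivity)]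
  set E := Real.exp (-(τ * freqNorm k ^ (1 / s)))
  calc freqNorm k ^ n * (|B| * E) * (1 + freqNorm k) ^ (2 * d)
      ≤ (1 + freqNorm k) ^ n * (|B| * E) * (1 + freqNorm k) ^ (2 * d) := by
        gcongr
        linarith
    _ = |B| * ((1 + freqNorm k) ^ (n + 2 * d) * E) := by rw [pow_add]; ring
    _ ≤ |B| * A := by gcongr

/-- One frequency does not affect summability; needed because the Gevrey norm gives no information
at `k = 0`. -/
lemma RapidDecay.of_le_of_ne_zero {E F : Type*} [NormedAddCommGroup E] [NormedAddCommGroup F]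
    {c : (Fin d → ℤ) → E} {b : (Fin d → ℤ) → F} (hc : RapidDecay c)
    (h : ∀ k, k ≠ 0 → ‖b k‖ ≤ ‖c k‖) : RapidDecay b := by
  intro n
  refine Summable.of_norm_bounded_eventually (hc n) ?_
  filter_upwards [(Set.finite_singleton (0 : Fin d → ℤ)).compl_mem_cofinite] with k hk
  rw [Real.norm_of_nonneg (mul_nonneg (pow_nonneg (freqNorm_nonneg k) n) (norm_nonneg _))]
  exact mul_le_mul_of_nonneg_left (h k hk) (pow_nonneg (freqNorm_nonneg k) n)

/-- The Gevrey norm in terms of a sequence of Fourier coefficients. -/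
def gevreySeqNorm (s r τ : ℝ) (c : (Fin d → ℤ) → ℂ) : ℝ≥0∞ :=
  (∑' k : {k : Fin d → ℤ // k ≠ 0},
    ENNReal.ofReal (freqNorm k.1 ^ (2 * r) * Real.exp (2 * τ * freqNorm k.1 ^ (1 / s)) *
      ‖c k.1‖ ^ 2)) ^ (1 / 2 : ℝ)

lemma gevreyNorm_eq (s r τ : ℝ) (f : (Fin d → ℝ) → ℝ) :
    gevreyNorm s r τ f = gevreySeqNorm s r τ (fourierCoefficient f) := rfl

lemma sq_weight_le_of_gevreySeqNorm_le {s r τ C : ℝ} {c : (Fin d → ℤ) → ℂ}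
    (h : gevreySeqNorm s r τ c ≤ ENNReal.ofReal C) {k : Fin d → ℤ} (hk : k ≠ 0) :
    freqNorm k ^ (2 * r) * Real.exp (2 * τ * freqNorm k ^ (1 / s)) * ‖c k‖ ^ 2 ≤
      (max C 0) ^ 2 := by
  -- `C` is not assumed nonnegative; passing to `max C 0` makes squaring legitimate.
  have hC : ENNReal.ofReal C = ENNReal.ofReal (max C 0) := by simp
  rw [gevreySeqNorm, hC, one_div (2 : ℝ), ENNReal.rpow_inv_le_iff (by norm_num)] at h
  have h1 := (ENNReal.le_tsum (f := fun k : {k : Fin d → ℤ // k ≠ 0} =>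
    ENNReal.ofReal (freqNorm k.1 ^ (2 * r) * Real.exp (2 * τ * freqNorm k.1 ^ (1 / s)) *
      ‖c k.1‖ ^ 2)) ⟨k, hk⟩).trans h
  rw [ENNReal.ofReal_rpow_of_nonneg (le_max_right _ _) (by norm_num)] at h1
  have h2 := (ENNReal.ofReal_le_ofReal_iff (by positivity)).mp h1
  simpa using h2

lemma norm_le_gevreyDecay {s r τ C : ℝ} (hr : 0 ≤ r) {c : (Fin d → ℤ) → ℂ}
    (h : gevreySeqNorm s r τ c ≤ ENNReal.ofReal C) {k : Fin d → ℤ} (hk : k ≠ 0) :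
    ‖c k‖ ≤ gevreyDecay s τ (max C 0) k := by
  have h1 := sq_weight_le_of_gevreySeqNorm_le h hk
  have h2 : 1 ≤ freqNorm k ^ (2 * r) := Real.one_le_rpow (one_le_freqNorm hk) (by positivity)
  set E := Real.exp (τ * freqNorm k ^ (1 / s)) with hE
  have hE0 : 0 < E := Real.exp_pos _
  have h3 : Real.exp (2 * τ * freqNorm k ^ (1 / s)) = E ^ 2 := by
    rw [hE, ← Real.exp_nat_mul]
    congr 1
    push_cast
    ring
  have h4 : (E * ‖c k‖) ^ 2 ≤ (max C 0) ^ 2 := by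
    refine le_trans ?_ h1
    rw [h3, mul_pow, mul_assoc]
    exact le_mul_of_one_le_left (by positivity) h2
  have h5 : E * ‖c k‖ ≤ max C 0 :=
    (pow_le_pow_iff_left₀ (by positivity) (le_max_right _ _) two_ne_zero).mp h4
  rw [gevreyDecay, Real.exp_neg, ← div_eq_mul_inv, le_div_iff₀ hE0, mul_comm]
  exact h5

lemma gevreyDecay_nonneg {s τ B : ℝ} (hB : 0 ≤ B) (k : Fin d → ℤ) :
    0 ≤ gevreyDecay s τ B k := mul_nonneg hB (Real.exp_pos _).le

lemma RapidDecay.of_le_gevreyDecay {s τ B : ℝ} (hs : 1 ≤ s) (hτ : 0 < τ) (hB : 0 ≤ B)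
    {c : (Fin d → ℤ) → ℂ} (h : ∀ k, k ≠ 0 → ‖c k‖ ≤ gevreyDecay s τ B k) : RapidDecay c :=
  (rapidDecay_gevreyDecay hs hτ B).of_le_of_ne_zero fun k hk => by
    rw [Real.norm_of_nonneg (gevreyDecay_nonneg hB k)]
    exact h k hk

lemma IsGevrey.rapidDecay {s r τ : ℝ} (hs : 1 ≤ s) (hr : 0 ≤ r) (hτ : 0 < τ)
    {f : (Fin d → ℝ) → ℝ} (hf : IsGevrey s r τ f) : RapidDecay (fourierCoefficient f) := by
  have h : gevreySeqNorm s r τ (fourierCoefficient f) ≤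
      ENNReal.ofReal (gevreyNorm s r τ f).toReal := by
    rw [ENNReal.ofReal_toReal hf.norm_lt_top.ne, gevreyNorm_eq]
  exact RapidDecay.of_le_gevreyDecay hs hτ (le_max_right _ _) fun k hk => norm_le_gevreyDecay hr h hk

end GevreyWeights

/-! ### Gevrey-class solutions and their Fourier modes -/

section Modes

variable {d : ℕ}

/-- The Fourier modes `α_k ∈ C([0,Tbar])` solve the active scalar equation in integral form. -/
structure IsModeSolution {Tbar : ℝ} (hT : 0 ≤ Tbar) (m : Fin d → Fin d → (Fin d → ℤ) → ℂ)
    (F a₀ : (Fin d → ℤ) → ℂ) (D : (Fin d → ℤ) → ℝ)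
    (α : (Fin d → ℤ) → C(Set.Icc (0 : ℝ) Tbar, ℂ)) : Prop where
  norm_le : ∀ k, k ≠ 0 → ‖α k‖ ≤ D k
  equation : ∀ k (t : Set.Icc (0 : ℝ) Tbar),
    α k t = a₀ k + ∫ σ in (0 : ℝ)..t, (F k + quadratic m α k (Set.projIcc 0 Tbar hT σ))

/-- Evaluation at a time is a continuous linear map, so it commutes with the series, which converges
in the sup norm. -/
lemma quadratic_apply {X : Type*} [TopologicalSpace X] [CompactSpace X]
    {m : Fin d → Fin d → (Fin d → ℤ) → ℂ} {C : ℝ} {D : (Fin d → ℤ) → ℝ}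
    (hm : ∀ i j k, ‖m i j k‖ ≤ C) (hC : 0 ≤ C) (hD : RapidDecay D)
    {α : (Fin d → ℤ) → C(X, ℂ)} (hα : ∀ k, k ≠ 0 → ‖α k‖ ≤ D k) (k : Fin d → ℤ) (t : X) :
    quadratic m α k t = quadratic m (fun l => α l t) k :=
  (ContinuousMap.evalCLM ℂ t).map_tsum (summable_quadratic_term hm hC hD hα k)

/-- The Fourier coefficients of a solution satisfy the mode equations. -/
lemma IsGevreySolution.hasDerivWithinAt_fourierCoefficient
    {T : SymbolFamily d} {ν C s r τbar Tbar : ℝ}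
    {S θ₀ : (Fin d → ℝ) → ℝ} {θ : ℝ → (Fin d → ℝ) → ℝ} {D : (Fin d → ℤ) → ℝ}
    (hm : ∀ i j k, ‖T ν i j k‖ ≤ C) (hC : 0 ≤ C)
    (hT : ∀ i j k, T ν i j (-k) = (starRingEnd ℂ) (T ν i j k))
    (hsol : IsGevreySolution T ν s r τbar Tbar S θ₀ θ)
    (hD : RapidDecay D)
    (hθ : ∀ t ∈ Set.Icc 0 Tbar, ∀ k, k ≠ 0 → ‖fourierCoefficient (θ t) k‖ ≤ D k)
    (hSp : IsPeriodic S) (hSc : Continuous S) (hS : RapidDecay (fourierCoefficient S))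
    {t : ℝ} (ht : t ∈ Set.Icc 0 Tbar) (k : Fin d → ℤ) :
    HasDerivWithinAt (fun t' => fourierCoefficient (θ t') k)
      (fourierCoefficient S k + quadratic (T ν) (fourierCoefficient (θ t)) k)
      (Set.Icc 0 Tbar) t := by
  have hqle : ∀ t ∈ Set.Icc 0 Tbar, ∀ k,
      ‖quadratic (T ν) (fourierCoefficient (θ t)) k‖ ≤ d ^ 2 * C * quadraticMajorant D k :=
    fun t ht => norm_quadratic_le hm hC hD (hθ t ht)
  have hqs : ∀ t ∈ Set.Icc 0 Tbar,
      Summable fun k => ‖quadratic (T ν) (fourierCoefficient (θ t)) k‖ := fun t ht =>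
    Summable.of_nonneg_of_le (fun _ => norm_nonneg _) (hqle t ht)
      ((summable_quadraticMajorant hD).mul_left _)
  have hcs : ∀ t ∈ Set.Icc 0 Tbar, Summable fun k =>
      ‖fourierCoefficient S k + quadratic (T ν) (fourierCoefficient (θ t)) k‖ := fun t ht =>
    Summable.of_nonneg_of_le (fun _ => norm_nonneg _) (fun _ => norm_add_le _ _)
      (hS.summable.add (hqs t ht))
  have hrapid : ∀ t ∈ Set.Icc 0 Tbar, RapidDecay (fourierCoefficient (θ t)) := fun t ht =>
    hD.of_le_of_ne_zero fun k hk => (hθ t ht k hk).trans (le_abs_self _)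
  set g : ℝ → (Fin d → ℝ) → ℝ := fun t x =>
    S x - ∑ j, velocity T ν (θ t) j x * partialDeriv j (θ t) x with hg
  have hgser : ∀ t ∈ Set.Icc 0 Tbar, ∀ x, (g t x : ℂ) = fourierSeries (fun k =>
      fourierCoefficient S k + quadratic (T ν) (fourierCoefficient (θ t)) k) x := by
    intro t ht x
    have hθt := hsol.gevrey t ht
    rw [fourierSeries_add hS.summable (hqs t ht), ← eq_fourierSeries hSp hSc hS.summable, hg,
      Complex.ofReal_sub, sum_velocity_mul_partialDeriv hm hT hθt.periodic hθt.smooth.continuous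
        (hrapid t ht), sub_neg_eq_add]
  have hcoef := fourierCoefficient_of_eq_fourierSeries (hcs t ht) (hgser t ht) k
  rw [← hcoef]
  refine ActiveScalar.hasDerivWithinAt_fourierCoefficient (convex_Icc 0 Tbar)
    (B := (∑' k, ‖fourierCoefficient S k‖) + ∑' k, d ^ 2 * C * quadraticMajorant D k)
    (fun t ht => (hsol.gevrey t ht).smooth.continuous) hsol.equation ?_ ht k
  intro t ht x
  change ‖g t x‖ ≤ _
  rw [← Complex.norm_real, hgser t ht x]
  have hmaj := (summable_quadraticMajorant hD).mul_left ((d : ℝ) ^ 2 * C)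
  refine (norm_fourierSeries_le (hcs t ht) x).trans ?_
  rw [← hS.summable.tsum_add hmaj]
  exact (hcs t ht).tsum_le_tsum
    (fun k => (norm_add_le _ _).trans (by gcongr; exact hqle t ht k)) (hS.summable.add hmaj)

/-- The modes of a Gevrey-class solution, as continuous functions of time. -/
lemma IsGevreySolution.exists_isModeSolution
    {T : SymbolFamily d} {ν C s r τbar Tbar : ℝ} (hTbar : 0 ≤ Tbar)
    {S θ₀ : (Fin d → ℝ) → ℝ} {θ : ℝ → (Fin d → ℝ) → ℝ} {D : (Fin d → ℤ) → ℝ}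
    (hm : ∀ i j k, ‖T ν i j k‖ ≤ C) (hC : 0 ≤ C)
    (hT : ∀ i j k, T ν i j (-k) = (starRingEnd ℂ) (T ν i j k))
    (hsol : IsGevreySolution T ν s r τbar Tbar S θ₀ θ)
    (hD : RapidDecay D) (hD0 : ∀ k, 0 ≤ D k)
    (hθ : ∀ t ∈ Set.Icc 0 Tbar, ∀ k, k ≠ 0 → ‖fourierCoefficient (θ t) k‖ ≤ D k)
    (hSp : IsPeriodic S) (hSc : Continuous S) (hS : RapidDecay (fourierCoefficient S)) :
    ∃ α : (Fin d → ℤ) → C(Set.Icc (0 : ℝ) Tbar, ℂ),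
      (∀ k (t : Set.Icc (0 : ℝ) Tbar), α k t = fourierCoefficient (θ t) k) ∧
      IsModeSolution hTbar (T ν) (fourierCoefficient S) (fourierCoefficient θ₀) D α := by
  have hderiv := fun (k : Fin d → ℤ) (t : ℝ) (ht : t ∈ Set.Icc 0 Tbar) =>
    hsol.hasDerivWithinAt_fourierCoefficient hm hC hT hD hθ hSp hSc hS ht k
  have hcont : ∀ k, ContinuousOn (fun t => fourierCoefficient (θ t) k) (Set.Icc 0 Tbar) :=
    fun k t ht => (hderiv k t ht).continuousWithinAt
  let α : (Fin d → ℤ) → C(Set.Icc (0 : ℝ) Tbar, ℂ) := fun k =>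
    ⟨fun t => fourierCoefficient (θ t) k, (hcont k).domRestrict⟩
  have hα : ∀ k (t : Set.Icc (0 : ℝ) Tbar), α k t = fourierCoefficient (θ t) k := fun _ _ => rfl
  have hnorm : ∀ k, k ≠ 0 → ‖α k‖ ≤ D k := fun k hk =>
    (ContinuousMap.norm_le _ (hD0 k)).mpr fun t => hθ t t.2 k hk
  refine ⟨α, hα, hnorm, fun k t => ?_⟩
  have h0 : fourierCoefficient θ₀ k = fourierCoefficient (θ 0) k := by
    rw [show θ 0 = θ₀ from funext hsol.initial]
  have hq : ∀ σ (hσ : σ ∈ Set.Icc 0 Tbar),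
      quadratic (T ν) α k (Set.projIcc 0 Tbar hTbar σ) =
        quadratic (T ν) (fourierCoefficient (θ σ)) k := by
    intro σ hσ
    rw [quadratic_apply hm hC hD hnorm, Set.projIcc_of_mem hTbar hσ]
    rfl
  have hint : Continuous fun σ : ℝ =>
      fourierCoefficient S k + quadratic (T ν) α k (Set.projIcc 0 Tbar hTbar σ) :=
    continuous_const.add ((quadratic (T ν) α k).continuous.comp continuous_projIcc)
  -- Continuity up to the ends and derivatives in the interior suffice here. The integral form is
  -- used because it passes to uniform limits.
  have hFTC := intervalIntegral.integral_eq_sub_of_hasDerivAt_of_le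
    (f := fun t => fourierCoefficient (θ t) k) t.2.1
    ((hcont k).mono (Set.Icc_subset_Icc_right t.2.2))
    (fun σ hσ => by
      have hσ' : σ ∈ Set.Icc 0 Tbar := ⟨hσ.1.le, hσ.2.le.trans t.2.2⟩
      have := hderiv k σ hσ'
      rw [← hq σ hσ'] at this
      exact this.hasDerivAt (Icc_mem_nhds hσ.1 (hσ.2.trans_le t.2.2)))
    (hint.intervalIntegrable _ _)
  rw [hFTC, hα, h0]
  ring

lemma IsModeSolution.hasDerivWithinAt {Tbar C : ℝ} {hT : 0 ≤ Tbar}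
    {m : Fin d → Fin d → (Fin d → ℤ) → ℂ}
    {F a₀ : (Fin d → ℤ) → ℂ} {D : (Fin d → ℤ) → ℝ}
    {α : (Fin d → ℤ) → C(Set.Icc (0 : ℝ) Tbar, ℂ)}
    (hα : IsModeSolution hT m F a₀ D α)
    (hm : ∀ i j k, ‖m i j k‖ ≤ C) (hC : 0 ≤ C) (hD : RapidDecay D) (k : Fin d → ℤ)
    {t : ℝ} (ht : t ∈ Set.Icc 0 Tbar) :
    HasDerivWithinAt (fun t' => α k (Set.projIcc 0 Tbar hT t'))
      (F k + quadratic m (fun l => α l (Set.projIcc 0 Tbar hT t)) k) (Set.Icc 0 Tbar) t := by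
  have hint : Continuous fun σ : ℝ => F k + quadratic m α k (Set.projIcc 0 Tbar hT σ) :=
    continuous_const.add ((quadratic m α k).continuous.comp continuous_projIcc)
  have h := ((hint.integral_hasStrictDerivAt 0 t).hasDerivAt.const_add (a₀ k)).hasDerivWithinAt
    (s := Set.Icc 0 Tbar)
  rw [quadratic_apply hm hC hD hα.norm_le] at h
  refine h.congr_of_mem (fun t' ht' => ?_) ht
  rw [hα.equation, Set.projIcc_of_mem hT ht']

/-- Modes that satisfy the mode equations are those of a Gevrey-class solution. -/
lemma IsModeSolution.isGevreySolution {T : SymbolFamily d} {ν C B s r τbar Tbar : ℝ}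
    {hTbar : 0 ≤ Tbar} {S θ₀ : (Fin d → ℝ) → ℝ} {D : (Fin d → ℤ) → ℝ}
    {α : (Fin d → ℤ) → C(Set.Icc (0 : ℝ) Tbar, ℂ)}
    (hα : IsModeSolution hTbar (T ν) (fourierCoefficient S) (fourierCoefficient θ₀) D α)
    (hm : ∀ i j k, ‖T ν i j k‖ ≤ C) (hC : 0 ≤ C)
    (hT : ∀ i j k, T ν i j (-k) = (starRingEnd ℂ) (T ν i j k))
    (hD : RapidDecay D)
    (hSp : IsPeriodic S) (hSc : Continuous S) (hS : RapidDecay (fourierCoefficient S))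
    (hθp : IsPeriodic θ₀) (hθc : Continuous θ₀) (hθ₀ : RapidDecay (fourierCoefficient θ₀))
    (hconj : ∀ k t, α (-k) t = (starRingEnd ℂ) (α k t))
    (hB : ∀ t, gevreySeqNorm s r τbar (fun k => α k t) ≤ ENNReal.ofReal B) :
    IsGevreySolution T ν s r τbar Tbar S θ₀
      fun t x => (fourierSeries (fun k => α k (Set.projIcc 0 Tbar hTbar t)) x).re := by
  set θ : ℝ → (Fin d → ℝ) → ℝ :=
    fun t x => (fourierSeries (fun k => α k (Set.projIcc 0 Tbar hTbar t)) x).re with hθ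
  have hle : ∀ t k, k ≠ 0 → ‖α k t‖ ≤ D k := fun t k hk =>
    ((α k).norm_coe_le_norm t).trans (hα.norm_le k hk)
  have hrapid : ∀ t, RapidDecay fun k => α k t := fun t =>
    hD.of_le_of_ne_zero fun k hk => (hle t k hk).trans (le_abs_self _)
  have hcast : ∀ t x, ((θ t x : ℝ) : ℂ) =
      fourierSeries (fun k => α k (Set.projIcc 0 Tbar hTbar t)) x :=
    fun t x => fourierSeries_conj (fun k => hconj k _) x
  have hcoef : ∀ t, fourierCoefficient (θ t) = fun k => α k (Set.projIcc 0 Tbar hTbar t) :=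
    fun t => funext fun k => fourierCoefficient_of_eq_fourierSeries (hrapid _).summable (hcast t) k
  have hper : ∀ t, IsPeriodic (θ t) := fun t i x => by
    simp only [hθ, fourierSeries_periodic]
  have hsm : ∀ t, ContDiff ℝ ∞ (θ t) := fun t => contDiff_re_fourierSeries (hrapid _)
  have hnorm : ∀ t, gevreyNorm s r τbar (θ t) ≤ ENNReal.ofReal B := fun t => by
    rw [gevreyNorm_eq, hcoef]
    exact hB _
  have hqle : ∀ t k, ‖quadratic (T ν) (fun l => α l t) k‖ ≤ d ^ 2 * C * quadraticMajorant D k :=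
    fun t => norm_quadratic_le hm hC hD (hle t)
  have hmaj := (summable_quadraticMajorant hD).mul_left ((d : ℝ) ^ 2 * C)
  refine ⟨fun t _ => ⟨hper t, hsm t, (hnorm t).trans_lt ENNReal.ofReal_lt_top⟩,
    ⟨B, fun t _ => hnorm t⟩, fun x => ?_, fun t ht x => ?_⟩
  · have h0 : ∀ k, α k (Set.projIcc 0 Tbar hTbar 0) = fourierCoefficient θ₀ k := by
      intro k
      rw [hα.equation, Set.projIcc_left]
      simp
    simp only [hθ, h0]
    rw [← eq_fourierSeries hθp hθc hθ₀.summable, Complex.ofReal_re]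
  · have h := hasDerivWithinAt_fourierSeries (convex_Icc 0 Tbar) (hS.summable.add hmaj)
      (fun t _ => (hrapid (Set.projIcc 0 Tbar hTbar t)).summable)
      (fun k t ht => hα.hasDerivWithinAt hm hC hD k ht)
      (fun k t _ => (norm_add_le _ _).trans (by gcongr; exact hqle _ k)) ht x
    have hre := Complex.reCLM.hasFDerivAt.comp_hasDerivWithinAt t h
    refine hre.congr_deriv ?_
    rw [fourierSeries_add hS.summable (Summable.of_nonneg_of_le (fun _ => norm_nonneg _)
      (hqle _) hmaj), ← eq_fourierSeries hSp hSc hS.summable]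
    have hv := sum_velocity_mul_partialDeriv hm hT (hper t) (hsm t).continuous
      (by rw [hcoef]; exact hrapid _) x
    rw [hcoef, eq_comm, neg_eq_iff_eq_neg] at hv
    rw [hv]
    simp only [Complex.reCLM_apply, Complex.add_re, Complex.ofReal_re, ← Complex.ofReal_neg]
    rw [sub_eq_add_neg]

end Modes

/-! ### Convergence of the symbols -/

section Symbols

variable {d : ℕ}

/-- (A5) is tested on `cos (l · x)`, a real function with nonzero coefficient at `l`; one term of
the sum is bounded by the whole. -/
lemma CondA5.tendsto_symbol {T : SymbolFamily d} (hA5 : CondA5 T) (i j : Fin d)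
    (l : Fin d → ℤ) : Tendsto (fun ν => T ν i j l) (𝓝[>] 0) (𝓝 (T 0 i j l)) := by
  classical
  have hfin : IsFiniteMeasure (volume.restrict (cell d)) :=
    ⟨by simpa using measure_cell_lt_top⟩
  set g : (Fin d → ℝ) → ℝ := fun x => Real.cos (phase l x) with hg
  have hgc : Continuous g := Real.continuous_cos.comp (continuous_phase l)
  have hgL : MemLp g 2 (volume.restrict (cell d)) :=
    MemLp.of_bound hgc.aestronglyMeasurable 1 (ae_of_all _ fun x => Real.abs_cos_le_one _)
  have hsingle : ∀ n : Fin d → ℤ,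
      Summable fun k => ‖(Pi.single n (1 / 2) : (Fin d → ℤ) → ℂ) k‖ := fun n =>
    summable_of_ne_finset_zero (s := {n}) fun k hk => by
      rw [Pi.single_eq_of_ne (by simpa using hk), norm_zero]
  have hseries : ∀ (n : Fin d → ℤ) x,
      fourierSeries (Pi.single n (1 / 2)) x = 1 / 2 * character n x := by
    intro n x
    rw [fourierSeries, tsum_eq_single n fun k hk => by rw [Pi.single_eq_of_ne hk, zero_mul],
      Pi.single_eq_same]
  set c : (Fin d → ℤ) → ℂ := fun k =>
    (Pi.single l (1 / 2) : (Fin d → ℤ) → ℂ) k + (Pi.single (-l) (1 / 2) : (Fin d → ℤ) → ℂ) k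
    with hc
  have hgs : ∀ x, (g x : ℂ) = fourierSeries c x := by
    intro x
    rw [hc, fourierSeries_add (hsingle l) (hsingle (-l)), hseries, hseries, hg,
      Complex.ofReal_cos, Complex.cos, character, character, phase_neg_left]
    push_cast
    ring_nf
  have hcoef := fourierCoefficient_of_eq_fourierSeries
    (Summable.of_nonneg_of_le (fun _ => norm_nonneg _) (fun _ => norm_add_le _ _)
      ((hsingle l).add (hsingle (-l)))) hgs l
  have hne : fourierCoefficient g l ≠ 0 := by
    rw [hcoef, Pi.single_eq_same]
    -- The coefficient is `1 / 2` in general, and `1` when the frequencies `l` and `-l` coincide.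
    by_cases h : l = -l
    · rw [← h, Pi.single_eq_same]
      norm_num
    · rw [Pi.single_eq_of_ne h]
      norm_num
  have h0 := hA5 i j g hgL
  have h1 : Tendsto (fun ν : ℝ => ENNReal.ofReal
      (‖T ν i j l - T 0 i j l‖ ^ 2 * ‖fourierCoefficient g l‖ ^ 2)) (𝓝[>] 0) (𝓝 0) :=
    tendsto_of_tendsto_of_tendsto_of_le_of_le tendsto_const_nhds h0 (fun _ => zero_le)
      fun ν => ENNReal.le_tsum (f := fun k => ENNReal.ofReal
        (‖T ν i j k - T 0 i j k‖ ^ 2 * ‖fourierCoefficient g k‖ ^ 2)) l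
  have h2 := (ENNReal.tendsto_toReal ENNReal.zero_ne_top).comp h1
  have h3 : Tendsto (fun ν : ℝ => ‖T ν i j l - T 0 i j l‖ ^ 2 * ‖fourierCoefficient g l‖ ^ 2)
      (𝓝[>] 0) (𝓝 0) := by
    refine h2.congr fun ν => ?_
    exact ENNReal.toReal_ofReal (by positivity)
  have h4 := h3.sqrt.div_const ‖fourierCoefficient g l‖
  rw [Real.sqrt_zero, zero_div] at h4
  refine tendsto_iff_norm_sub_tendsto_zero.mpr (h4.congr fun ν => ?_)
  rw [← mul_pow, Real.sqrt_sq (by positivity), mul_div_cancel_right₀ _ (norm_ne_zero_iff.mpr hne)]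

lemma tendsto_bilinearSymbol {ι : Type*} {l : Filter ι}
    {m : ι → Fin d → Fin d → (Fin d → ℤ) → ℂ} {m₀ : Fin d → Fin d → (Fin d → ℤ) → ℂ}
    (hm : ∀ i j k, Tendsto (fun ν => m ν i j k) l (𝓝 (m₀ i j k))) (p n : Fin d → ℤ) :
    Tendsto (fun ν => bilinearSymbol (m ν) p n) l (𝓝 (bilinearSymbol m₀ p n)) :=
  tendsto_finsetSum _ fun j _ => tendsto_finsetSum _ fun i _ => (hm i j p).const_mul _

end Symbols

/-! ### Compactness of families of mode solutions -/

section Compactness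

variable {d : ℕ}

/-- Arzelà–Ascoli. The Lipschitz inequality already forces continuity, so in the topology of
pointwise convergence the set is a closed subset of a product of closed balls, compact by Tychonoff;
the common constant gives equicontinuity. -/
lemma isCompact_setOf_bounded_lipschitz {X : Type*} [PseudoMetricSpace X] [CompactSpace X]
    (R : ℝ) (L : ℝ) :
    IsCompact {f : C(X, ℂ) | (∀ t, ‖f t‖ ≤ R) ∧ ∀ t t', ‖f t - f t'‖ ≤ L * dist t t'} := by
  refine ArzelaAscoli.isCompact_of_equicontinuous _ ?_ ?_
  · have himage : ContinuousMap.toFun ''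
        {f : C(X, ℂ) | (∀ t, ‖f t‖ ≤ R) ∧ ∀ t t', ‖f t - f t'‖ ≤ L * dist t t'} =
        (Set.univ.pi fun _ => Metric.closedBall (0 : ℂ) R) ∩
          {f : X → ℂ | ∀ t t', ‖f t - f t'‖ ≤ L * dist t t'} := by
      ext f
      constructor
      · rintro ⟨g, hg, rfl⟩
        exact ⟨fun t _ => mem_closedBall_zero_iff.mpr (hg.1 t), hg.2⟩
      · rintro ⟨h1, h2⟩
        have hlip : LipschitzWith L.toNNReal f := LipschitzWith.of_dist_le_mul fun t t' => by
          rw [dist_eq_norm]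
          exact (h2 t t').trans
            (mul_le_mul_of_nonneg_right (Real.le_coe_toNNReal L) dist_nonneg)
        exact ⟨⟨f, hlip.continuous⟩,
          ⟨fun t => mem_closedBall_zero_iff.mp (h1 t (Set.mem_univ t)), h2⟩, rfl⟩
    rw [himage]
    refine (isCompact_univ_pi fun _ => isCompact_closedBall _ _).inter_right ?_
    simp only [Set.ofPred_forall]
    exact isClosed_iInter fun t => isClosed_iInter fun t' =>
      isClosed_le (by fun_prop) continuous_const
  · refine (LipschitzWith.uniformEquicontinuous _ L.toNNReal fun f => ?_).equicontinuous
    refine LipschitzWith.of_dist_le_mul fun t t' => ?_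
    rw [dist_eq_norm]
    exact (f.2.2 t t').trans (mul_le_mul_of_nonneg_right (Real.le_coe_toNNReal L) dist_nonneg)

lemma IsModeSolution.norm_sub_le {Tbar C : ℝ} {hT : 0 ≤ Tbar}
    {m : Fin d → Fin d → (Fin d → ℤ) → ℂ}
    {F a₀ : (Fin d → ℤ) → ℂ} {D : (Fin d → ℤ) → ℝ}
    {α : (Fin d → ℤ) → C(Set.Icc (0 : ℝ) Tbar, ℂ)}
    (hα : IsModeSolution hT m F a₀ D α)
    (hm : ∀ i j k, ‖m i j k‖ ≤ C) (hC : 0 ≤ C) (hD : RapidDecay D) (k : Fin d → ℤ)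
    (t t' : Set.Icc (0 : ℝ) Tbar) :
    ‖α k t - α k t'‖ ≤ (‖F k‖ + d ^ 2 * C * quadraticMajorant D k) * dist t t' := by
  have hint : Continuous fun σ : ℝ => F k + quadratic m α k (Set.projIcc 0 Tbar hT σ) :=
    continuous_const.add ((quadratic m α k).continuous.comp continuous_projIcc)
  rw [hα.equation k t, hα.equation k t', add_sub_add_left_eq_sub,
    intervalIntegral.integral_interval_sub_left (hint.intervalIntegrable _ _)
      (hint.intervalIntegrable _ _)]
  refine (intervalIntegral.norm_integral_le_of_norm_le_const fun σ _ => ?_).trans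
    (le_of_eq (by rw [Subtype.dist_eq, Real.dist_eq]))
  refine (norm_add_le _ _).trans (add_le_add_right ?_ _)
  exact ((quadratic m α k).norm_coe_le_norm _).trans (norm_quadratic_le hm hC hD hα.norm_le k)

lemma IsModeSolution.apply_zero {Tbar : ℝ} {hT : 0 ≤ Tbar}
    {m : Fin d → Fin d → (Fin d → ℤ) → ℂ}
    {F a₀ : (Fin d → ℤ) → ℂ} {D : (Fin d → ℤ) → ℝ}
    {α : (Fin d → ℤ) → C(Set.Icc (0 : ℝ) Tbar, ℂ)}
    (hα : IsModeSolution hT m F a₀ D α) (k : Fin d → ℤ) :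
    α k ⟨0, Set.left_mem_Icc.mpr hT⟩ = a₀ k := by
  rw [hα.equation]
  simp

/-- Along an ultrafilter, mode solutions with convergent symbols converge to a mode solution. -/
lemma exists_tendsto_isModeSolution {ι : Type*} (U : Ultrafilter ι) {Tbar C : ℝ}
    {hT : 0 ≤ Tbar}
    {m : ι → Fin d → Fin d → (Fin d → ℤ) → ℂ} {m₀ : Fin d → Fin d → (Fin d → ℤ) → ℂ}
    {F a₀ : (Fin d → ℤ) → ℂ} {D : (Fin d → ℤ) → ℝ}
    {α : ι → (Fin d → ℤ) → C(Set.Icc (0 : ℝ) Tbar, ℂ)}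
    (hm : ∀ᶠ ν in (U : Filter ι), ∀ i j k, ‖m ν i j k‖ ≤ C) (hC : 0 ≤ C) (hD : RapidDecay D)
    (hα : ∀ᶠ ν in (U : Filter ι), IsModeSolution hT (m ν) F a₀ D (α ν))
    (hlim : ∀ i j k, Tendsto (fun ν => m ν i j k) U (𝓝 (m₀ i j k))) :
    ∃ β : (Fin d → ℤ) → C(Set.Icc (0 : ℝ) Tbar, ℂ),
      (∀ k, Tendsto (fun ν => α ν k) U (𝓝 (β k))) ∧ IsModeSolution hT m₀ F a₀ D β := by
  have hexists : ∀ k, ∃ β : C(Set.Icc (0 : ℝ) Tbar, ℂ),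
      Tendsto (fun ν => α ν k) U (𝓝 β) := by
    intro k
    set L := ‖F k‖ + d ^ 2 * C * quadraticMajorant D k with hL
    -- The radius is the size of the initial value plus the largest possible drift. This also bounds
    -- the zero mode, which `D` does not control.
    have hmem : ∀ᶠ ν in (U : Filter ι), α ν k ∈
        {f : C(Set.Icc (0 : ℝ) Tbar, ℂ) |
          (∀ t, ‖f t‖ ≤ ‖a₀ k‖ + L * Tbar) ∧ ∀ t t', ‖f t - f t'‖ ≤ L * dist t t'} := by
      filter_upwards [hm, hα] with ν hmν hαν
      have hlip := hαν.norm_sub_le hmν hC hD k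
      refine ⟨fun t => ?_, hlip⟩
      have h0 := hlip t ⟨0, Set.left_mem_Icc.mpr hT⟩
      rw [hαν.apply_zero] at h0
      have hL0 : 0 ≤ L := by
        have := (norm_nonneg _).trans (norm_quadratic_le hmν hC hD hαν.norm_le k)
        positivity
      have hdist : dist t ⟨0, Set.left_mem_Icc.mpr hT⟩ ≤ Tbar := by
        rw [Subtype.dist_eq, Real.dist_eq, sub_zero, abs_of_nonneg t.2.1]
        exact t.2.2
      calc ‖α ν k t‖ ≤ ‖a₀ k‖ + ‖α ν k t - a₀ k‖ := norm_le_norm_add_norm_sub' _ _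
        _ ≤ ‖a₀ k‖ + L * Tbar := by
            gcongr
            exact h0.trans (mul_le_mul_of_nonneg_left hdist hL0)
    obtain ⟨β, -, hβ⟩ := (isCompact_setOf_bounded_lipschitz _ _).ultrafilter_le_nhds'
      (U.map fun ν => α ν k) hmem
    exact ⟨β, hβ⟩
  choose β hβ using hexists
  -- Dominated convergence for series with values in `C([0,Tbar], ℂ)`: the limit is uniform in time
  -- and can be taken inside the time integral.
  have hquad : ∀ k, Tendsto (fun ν => quadratic (m ν) (α ν) k) U (𝓝 (quadratic m₀ β k)) := by
    intro k
    refine tendsto_tsum_of_dominated_convergence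
      (((summable_quadraticMajorant_prod hD).prod_factor k).mul_left ((d : ℝ) ^ 2 * C))
      (fun l => (tendsto_bilinearSymbol hlim l (k - l)).smul ((hβ l).mul (hβ (k - l)))) ?_
    filter_upwards [hm, hα] with ν hmν hαν l
    exact norm_quadratic_term_le hmν hC hαν.norm_le k l
  refine ⟨β, hβ, fun k hk => ?_, fun k t => ?_⟩
  · exact le_of_tendsto (hβ k).norm (hα.mono fun ν hν => hν.norm_le k hk)
  · have hcont : Continuous fun G : C(Set.Icc (0 : ℝ) Tbar, ℂ) =>
        a₀ k + ∫ σ in (0 : ℝ)..t, (F k + G (Set.projIcc 0 Tbar hT σ)) := by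
      refine continuous_const.add
        (intervalIntegral.continuous_parametric_intervalIntegral_of_continuous' ?_ _ _)
      have := (continuous_projIcc (h := hT) (a := (0 : ℝ)) (b := Tbar))
      simp only [Function.uncurry_def]
      fun_prop
    have h1 := (hcont.tendsto _).comp (hquad k)
    have h2 : Tendsto (fun ν => α ν k t) U (𝓝 (β k t)) :=
      ((continuous_eval_const t).tendsto _).comp (hβ k)
    refine tendsto_nhds_unique h2 (h1.congr' ?_)
    filter_upwards [hα] with ν hν
    exact (hν.equation k t).symm

end Compactness

/-! ### Uniqueness of analytic mode solutions -/

section AnalyticUniqueness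

variable {d : ℕ}

/-- Tonelli on the triangle `0 < σ ≤ t ≤ T`. -/
lemma lintegral_Ioc_mul_lintegral_Ioc (T : ℝ) {f g : ℝ → ℝ≥0∞} (hf : Measurable f)
    (hg : Measurable g) :
    ∫⁻ t in Set.Ioc 0 T, f t * ∫⁻ σ in Set.Ioc 0 t, g σ =
      ∫⁻ σ in Set.Ioc 0 T, g σ * ∫⁻ t in Set.Icc σ T, f t := by
  classical
  set h : ℝ → ℝ → ℝ≥0∞ := fun t σ => if 0 < σ ∧ σ ≤ t ∧ t ≤ T then f t * g σ else 0 with hh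
  have hmeas : Measurable (Function.uncurry h) := by
    refine Measurable.ite ?_ ((hf.comp measurable_fst).mul (hg.comp measurable_snd))
      measurable_const
    exact (measurableSet_lt measurable_const measurable_snd).inter
      ((measurableSet_le measurable_snd measurable_fst).inter
        (measurableSet_le measurable_fst measurable_const))
  have h1 : ∫⁻ t in Set.Ioc 0 T, f t * ∫⁻ σ in Set.Ioc 0 t, g σ = ∫⁻ t, ∫⁻ σ, h t σ := by
    rw [← lintegral_indicator measurableSet_Ioc]
    refine lintegral_congr fun t => ?_
    by_cases ht : t ∈ Set.Ioc 0 T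
    · rw [Set.indicator_of_mem ht, ← lintegral_indicator measurableSet_Ioc,
        ← lintegral_const_mul _ (hg.indicator measurableSet_Ioc)]
      refine lintegral_congr fun σ => ?_
      simp only [hh, Set.indicator_apply, Set.mem_Ioc, ht.2, and_true, mul_ite, mul_zero]
    · rw [Set.indicator_of_notMem ht]
      have : ∀ σ, h t σ = 0 := fun σ => if_neg fun hσ => ht ⟨hσ.1.trans_le hσ.2.1, hσ.2.2⟩
      simp [this]
  have h2 : ∫⁻ σ in Set.Ioc 0 T, g σ * ∫⁻ t in Set.Icc σ T, f t = ∫⁻ σ, ∫⁻ t, h t σ := by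
    rw [← lintegral_indicator measurableSet_Ioc]
    refine lintegral_congr fun σ => ?_
    by_cases hσ : σ ∈ Set.Ioc 0 T
    · rw [Set.indicator_of_mem hσ, ← lintegral_indicator measurableSet_Icc,
        ← lintegral_const_mul _ (hf.indicator measurableSet_Icc)]
      refine lintegral_congr fun t => ?_
      simp only [hh, Set.indicator_apply, Set.mem_Icc, hσ.1, true_and, mul_comm (g σ),
        ite_mul, zero_mul]
    · rw [Set.indicator_of_notMem hσ]
      have : ∀ t, h t σ = 0 := fun t => if_neg fun ht => hσ ⟨ht.1, ht.2.1.trans ht.2.2⟩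
      simp [this]
  rw [h1, h2]
  exact lintegral_lintegral_swap hmeas.aemeasurable

lemma tsum_convolution_ennreal (a b : (Fin d → ℤ) → ℝ≥0∞) :
    ∑' k, ∑' l, a l * b (k - l) = (∑' k, a k) * ∑' k, b k := by
  rw [ENNReal.tsum_comm, ← ENNReal.tsum_mul_right]
  refine tsum_congr fun l => ?_
  rw [ENNReal.tsum_mul_left]
  exact congrArg _ ((Equiv.subRight l).tsum_eq b)

/-- A submultiplicative weight distributes over the two factors, and `ℓ¹` is a convolution algebra.
The factor `N` in front of `y` on the right, absent on the left, is the loss of one derivative. -/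
lemma tsum_weighted_convolution_le (K : ℝ≥0∞) {N D E y : (Fin d → ℤ) → ℝ≥0∞}
    (hE : ∀ k l, E k ≤ E l * E (k - l)) :
    ∑' k, E k * ∑' l, K * (N l * N (k - l)) * (D l * y (k - l) + y l * D (k - l)) ≤
      2 * K * (∑' k, N k * E k * D k) * ∑' k, N k * E k * y k := by
  calc ∑' k, E k * ∑' l, K * (N l * N (k - l)) * (D l * y (k - l) + y l * D (k - l))
      ≤ ∑' k, ∑' l, (K * ((N l * E l * D l) * (N (k - l) * E (k - l) * y (k - l))) +
          K * ((N l * E l * y l) * (N (k - l) * E (k - l) * D (k - l)))) := by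
        refine ENNReal.tsum_le_tsum fun k => ?_
        rw [← ENNReal.tsum_mul_left]
        refine ENNReal.tsum_le_tsum fun l => ?_
        refine (mul_le_mul_left (hE k l) _).trans (le_of_eq ?_)
        ring
    _ = 2 * K * (∑' k, N k * E k * D k) * ∑' k, N k * E k * y k := by
        simp only [ENNReal.tsum_add, ENNReal.tsum_mul_left]
        rw [tsum_convolution_ennreal (fun l => N l * E l * D l) (fun l => N l * E l * y l),
          tsum_convolution_ennreal (fun l => N l * E l * y l) (fun l => N l * E l * D l)]
        ring

/-- The gain from a shrinking radius: `κ` times the exponential is an exact time derivative up to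
`-M⁻¹`, so time integration absorbs one derivative at the small price `M⁻¹`. -/
lemma lintegral_weight_le {M l κ : ℝ} (hM : 0 < M) (hκ : 0 ≤ κ) (σ T : ℝ) :
    ∫⁻ t in Set.Icc σ T, ENNReal.ofReal κ * ENNReal.ofReal (Real.exp ((l - M * t) * κ)) ≤
      ENNReal.ofReal M⁻¹ * ENNReal.ofReal (Real.exp ((l - M * σ) * κ)) := by
  rcases lt_or_ge T σ with hlt | hle
  · simp [Set.Icc_eq_empty (not_le.mpr hlt)]
  simp only [← ENNReal.ofReal_mul hκ, ← ENNReal.ofReal_mul (inv_nonneg.mpr hM.le)]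
  have hcont : Continuous fun t => κ * Real.exp ((l - M * t) * κ) := by fun_prop
  rw [← ofReal_integral_eq_lintegral_ofReal (hcont.integrableOn_Icc)
    (ae_of_all _ fun t => mul_nonneg hκ (Real.exp_pos _).le)]
  apply ENNReal.ofReal_le_ofReal
  rw [integral_Icc_eq_integral_Ioc, ← intervalIntegral.integral_of_le hle]
  have hderiv : ∀ t ∈ Set.uIcc σ T,
      HasDerivAt (fun t => -(M⁻¹ * Real.exp ((l - M * t) * κ)))
        (κ * Real.exp ((l - M * t) * κ)) t := by
    intro t _
    have h1 : HasDerivAt (fun t => (l - M * t) * κ) (-(M * 1) * κ) t :=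
      (((hasDerivAt_id t).const_mul M).const_sub l).mul_const κ
    refine (h1.exp.const_mul M⁻¹).neg.congr_deriv ?_
    field_simp
  rw [intervalIntegral.integral_eq_sub_of_hasDerivAt hderiv (hcont.intervalIntegrable _ _)]
  have : 0 ≤ M⁻¹ * Real.exp ((l - M * T) * κ) := by positivity
  linarith

/-- The difference of two mode solutions, estimated by the bilinear form of the equation. -/
lemma IsModeSolution.enorm_sub_le {Tbar C : ℝ} {hT : 0 ≤ Tbar}
    {m : Fin d → Fin d → (Fin d → ℤ) → ℂ}
    {F a₀ : (Fin d → ℤ) → ℂ} {D : (Fin d → ℤ) → ℝ}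
    {α β : (Fin d → ℤ) → C(Set.Icc (0 : ℝ) Tbar, ℂ)}
    (hα : IsModeSolution hT m F a₀ D α) (hβ : IsModeSolution hT m F a₀ D β)
    (hm : ∀ i j k, ‖m i j k‖ ≤ C) (hC : 0 ≤ C) (hD : RapidDecay D) (k : Fin d → ℤ)
    {t : ℝ} (ht : t ∈ Set.Icc 0 Tbar) :
    ‖α k (Set.projIcc 0 Tbar hT t) - β k (Set.projIcc 0 Tbar hT t)‖ₑ ≤
      ∫⁻ σ in Set.Ioc 0 t, ∑' l, ENNReal.ofReal (d ^ 2 * C) *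
        (ENNReal.ofReal (freqNorm l) * ENNReal.ofReal (freqNorm (k - l))) *
        (ENNReal.ofReal (D l) * ‖α (k - l) (Set.projIcc 0 Tbar hT σ) -
            β (k - l) (Set.projIcc 0 Tbar hT σ)‖ₑ +
          ‖α l (Set.projIcc 0 Tbar hT σ) - β l (Set.projIcc 0 Tbar hT σ)‖ₑ *
            ENNReal.ofReal (D (k - l))) := by
  have hint : ∀ {γ : (Fin d → ℤ) → C(Set.Icc (0 : ℝ) Tbar, ℂ)}, Continuous fun σ : ℝ =>
      F k + quadratic m γ k (Set.projIcc 0 Tbar hT σ) := fun {γ} =>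
    continuous_const.add ((quadratic m γ k).continuous.comp continuous_projIcc)
  rw [hα.equation, hβ.equation, add_sub_add_left_eq_sub, Set.projIcc_of_mem hT ht,
    ← intervalIntegral.integral_sub (hint.intervalIntegrable _ _) (hint.intervalIntegrable _ _),
    intervalIntegral.integral_of_le ht.1]
  refine (enorm_integral_le_lintegral_enorm _).trans (lintegral_mono fun σ => ?_)
  set p := Set.projIcc 0 Tbar hT σ
  have hle : ∀ {γ : (Fin d → ℤ) → C(Set.Icc (0 : ℝ) Tbar, ℂ)},
      IsModeSolution hT m F a₀ D γ → ∀ l, l ≠ 0 → ‖γ l p‖ ≤ D l := fun hγ l hl =>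
    ((ContinuousMap.norm_coe_le_norm _ _)).trans (hγ.norm_le l hl)
  have hweight : ∀ {γ : (Fin d → ℤ) → C(Set.Icc (0 : ℝ) Tbar, ℂ)},
      IsModeSolution hT m F a₀ D γ → ∀ l, ENNReal.ofReal (freqNorm l) * ‖γ l p‖ₑ ≤
        ENNReal.ofReal (freqNorm l) * ENNReal.ofReal (D l) := by
    intro γ hγ l
    rcases eq_or_ne l 0 with rfl | hl
    · simp [freqNorm_zero]
    · rw [← ofReal_norm]
      exact mul_le_mul_right (ENNReal.ofReal_le_ofReal (hle hγ l hl)) _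
  rw [add_sub_add_left_eq_sub, quadratic_apply hm hC hD hα.norm_le,
    quadratic_apply hm hC hD hβ.norm_le, quadratic, quadratic,
    ← (summable_quadratic_term hm hC hD (hle hα) k).tsum_sub
      (summable_quadratic_term hm hC hD (hle hβ) k)]
  refine enorm_tsum_le_tsum_enorm.trans (ENNReal.tsum_le_tsum fun l => ?_)
  set n := k - l
  have hsym : ‖bilinearSymbol m l n‖ₑ ≤ ENNReal.ofReal (d ^ 2 * C) *
      (ENNReal.ofReal (freqNorm l) * ENNReal.ofReal (freqNorm n)) := by
    rw [← ENNReal.ofReal_mul (freqNorm_nonneg l), ← ENNReal.ofReal_mul (by positivity),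
      ← ofReal_norm]
    exact ENNReal.ofReal_le_ofReal (norm_bilinearSymbol_le hm l n)
  have hsplit : bilinearSymbol m l n • (α l p * α n p) - bilinearSymbol m l n • (β l p * β n p) =
      bilinearSymbol m l n * (α l p * (α n p - β n p) + (α l p - β l p) * β n p) := by
    simp only [smul_eq_mul]
    ring
  rw [hsplit, enorm_mul]
  calc ‖bilinearSymbol m l n‖ₑ * ‖α l p * (α n p - β n p) + (α l p - β l p) * β n p‖ₑ
      ≤ ENNReal.ofReal (d ^ 2 * C) *
        (ENNReal.ofReal (freqNorm l) * ENNReal.ofReal (freqNorm n)) *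
        (‖α l p‖ₑ * ‖α n p - β n p‖ₑ + ‖α l p - β l p‖ₑ * ‖β n p‖ₑ) := by
        refine mul_le_mul' hsym ((enorm_add_le _ _).trans ?_)
        rw [enorm_mul, enorm_mul]
    _ = ENNReal.ofReal (d ^ 2 * C) *
        ((ENNReal.ofReal (freqNorm l) * ‖α l p‖ₑ) * (ENNReal.ofReal (freqNorm n) *
            ‖α n p - β n p‖ₑ) +
          (ENNReal.ofReal (freqNorm l) * ‖α l p - β l p‖ₑ) *
            (ENNReal.ofReal (freqNorm n) * ‖β n p‖ₑ)) := by ring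
    _ ≤ ENNReal.ofReal (d ^ 2 * C) *
        ((ENNReal.ofReal (freqNorm l) * ENNReal.ofReal (D l)) * (ENNReal.ofReal (freqNorm n) *
            ‖α n p - β n p‖ₑ) +
          (ENNReal.ofReal (freqNorm l) * ‖α l p - β l p‖ₑ) *
            (ENNReal.ofReal (freqNorm n) * ENNReal.ofReal (D n))) := by
        have h1 := hweight hα l
        have h2 := hweight hβ n
        gcongr
    _ = _ := by ring

/-- Analytic mode solutions with the same data agree on a short time interval, whose length
depends only on the bounds. -/
lemma exists_time_eq_of_isModeSolution {Tbar C τ B : ℝ} (hTbar : 0 < Tbar) (hC : 0 ≤ C)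
    (hτ : 0 < τ) (hB : 0 ≤ B) :
    ∃ T' : ℝ, 0 < T' ∧ T' < Tbar ∧
      ∀ (m : Fin d → Fin d → (Fin d → ℤ) → ℂ) (F a₀ : (Fin d → ℤ) → ℂ)
        (α β : (Fin d → ℤ) → C(Set.Icc (0 : ℝ) Tbar, ℂ)),
        (∀ i j k, ‖m i j k‖ ≤ C) →
        IsModeSolution hTbar.le m F a₀ (gevreyDecay 1 τ B) α →
        IsModeSolution hTbar.le m F a₀ (gevreyDecay 1 τ B) β →
        ∀ t : Set.Icc (0 : ℝ) Tbar, (t : ℝ) ≤ T' → ∀ k, k ≠ 0 → α k t = β k t := by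
  -- The initial radius is strictly below `τ`, which makes the weighted sum `A` of the majorant
  -- finite.
  set l := τ / 2 with hl
  have hl0 : 0 < l := by positivity
  set D : (Fin d → ℤ) → ℝ := gevreyDecay 1 τ B with hD
  have hDr : RapidDecay D := rapidDecay_gevreyDecay le_rfl hτ B
  have hD0 : ∀ k, 0 ≤ D k := gevreyDecay_nonneg hB
  have hexpD : ∀ k, freqNorm k * Real.exp (l * freqNorm k) * D k =
      freqNorm k * gevreyDecay 1 l B k := by
    intro k
    simp only [hD, gevreyDecay, div_one, Real.rpow_one]
    rw [show -(l * freqNorm k) = l * freqNorm k + -(τ * freqNorm k) by rw [hl]; ring,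
      Real.exp_add]
    ring
  have hterm0 : ∀ k, 0 ≤ freqNorm k * Real.exp (l * freqNorm k) * D k := fun k =>
    mul_nonneg (mul_nonneg (freqNorm_nonneg k) (Real.exp_pos _).le) (hD0 k)
  have hAs : Summable fun k => freqNorm k * Real.exp (l * freqNorm k) * D k := by
    simp only [hexpD]
    simpa [Real.norm_of_nonneg (gevreyDecay_nonneg hB _)] using
      (rapidDecay_gevreyDecay (d := d) le_rfl hl0 B) 1
  set A := ∑' k, freqNorm k * Real.exp (l * freqNorm k) * D k with hA
  have hA0 : 0 ≤ A := tsum_nonneg hterm0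
  have hAe : ∑' k : Fin d → ℤ, ENNReal.ofReal (freqNorm k) *
      ENNReal.ofReal (Real.exp (l * freqNorm k)) * ENNReal.ofReal (D k) = ENNReal.ofReal A := by
    rw [hA, ENNReal.ofReal_tsum_of_nonneg hterm0 hAs]
    refine tsum_congr fun k => ?_
    rw [ENNReal.ofReal_mul (mul_nonneg (freqNorm_nonneg k) (Real.exp_pos _).le),
      ENNReal.ofReal_mul (freqNorm_nonneg k)]
  set K : ℝ := d ^ 2 * C with hK
  have hK0 : 0 ≤ K := by positivity
  -- Chosen so that `2 K A / M ≤ 1 / 2`; the summand `1` keeps `M` positive. The bound `l / M` on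
  -- the time below keeps the radius `l - M t` nonnegative.
  set M := 4 * K * A + 1 with hM
  have hM0 : 0 < M := by positivity
  set T' := min (Tbar / 2) (l / M) with hT'
  have hT'0 : 0 < T' := lt_min (by positivity) (by positivity)
  have hT'lt : T' < Tbar := (min_le_left _ _).trans_lt (by linarith)
  refine ⟨T', hT'0, hT'lt, fun m F a₀ α β hm hα hβ => ?_⟩
  set N : (Fin d → ℤ) → ℝ≥0∞ := fun k => ENNReal.ofReal (freqNorm k) with hN
  set E : ℝ → (Fin d → ℤ) → ℝ≥0∞ := fun t k =>
    ENNReal.ofReal (Real.exp ((l - M * t) * freqNorm k)) with hE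
  set y : ℝ → (Fin d → ℤ) → ℝ≥0∞ := fun t k =>
    ‖α k (Set.projIcc 0 Tbar hTbar.le t) - β k (Set.projIcc 0 Tbar hTbar.le t)‖ₑ with hy
  set G : ℝ → (Fin d → ℤ) → ℝ≥0∞ := fun t k => ∑' n, ENNReal.ofReal K * (N n * N (k - n)) *
    (ENNReal.ofReal (D n) * y t (k - n) + y t n * ENNReal.ofReal (D (k - n))) with hG
  have hproj : Continuous (Set.projIcc 0 Tbar hTbar.le) := continuous_projIcc
  have hym : ∀ k, Measurable fun t => y t k := fun k =>
    (((α k).continuous.comp hproj).sub ((β k).continuous.comp hproj)).enorm.measurable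
  have hEm : ∀ k, Measurable fun t => E t k := fun k => by
    have : Continuous fun t => Real.exp ((l - M * t) * freqNorm k) := by fun_prop
    exact this.measurable.ennreal_ofReal
  have hGm : ∀ k, Measurable fun t => G t k := fun k =>
    Measurable.tsum fun n => Measurable.const_mul
      (((hym _).const_mul _).add ((hym _).mul_const _)) _
  have hyle : ∀ t ∈ Set.Icc 0 Tbar, ∀ k, y t k ≤ ∫⁻ σ in Set.Ioc 0 t, G σ k := fun t ht k =>
    hα.enorm_sub_le hβ hm hC hDr k ht
  set X := ∫⁻ t in Set.Ioc 0 T', ∑' k, N k * E t k * y t k with hX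
  have hEle : ∀ t, 0 ≤ t → ∀ k, E t k ≤ ENNReal.ofReal (Real.exp (l * freqNorm k)) := by
    intro t ht k
    have := freqNorm_nonneg k
    refine ENNReal.ofReal_le_ofReal (Real.exp_le_exp.mpr ?_)
    gcongr
    have : 0 ≤ M * t := by positivity
    linarith
  -- The triangle inequality for frequencies gives this only while the radius is nonnegative.
  have hEsub : ∀ t, t ≤ T' → ∀ k n, E t k ≤ E t n * E t (k - n) := by
    intro t ht k n
    rw [hE]
    simp only
    rw [← ENNReal.ofReal_mul (Real.exp_pos _).le, ← Real.exp_add, ← mul_add]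
    refine ENNReal.ofReal_le_ofReal (Real.exp_le_exp.mpr ?_)
    have h1 : M * t ≤ l := by
      have := (le_div_iff₀ hM0).mp (ht.trans (min_le_right _ _))
      linarith
    refine mul_le_mul_of_nonneg_left ?_ (by linarith)
    have := freqNorm_add_le n (k - n)
    rwa [add_sub_cancel] at this
  have hGle : ∀ t ∈ Set.Ioc 0 T', ∑' k, E t k * G t k ≤
      ENNReal.ofReal (2 * K * A) * ∑' k, N k * E t k * y t k := by
    intro t ht
    refine (tsum_weighted_convolution_le (ENNReal.ofReal K) (hEsub t ht.2)).trans ?_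
    gcongr
    calc 2 * ENNReal.ofReal K * ∑' k, N k * E t k * ENNReal.ofReal (D k)
        ≤ 2 * ENNReal.ofReal K * ENNReal.ofReal A := by
          rw [← hAe]
          gcongr with k
          exact hEle t ht.1.le k
      _ = ENNReal.ofReal (2 * K * A) := by
          rw [ENNReal.ofReal_mul (p := 2 * K) (by positivity),
            ENNReal.ofReal_mul (p := 2) (by positivity), ENNReal.ofReal_ofNat]
  -- Insert the integral inequality for `y`, exchange the time integrals, integrate the weight, and
  -- apply the bilinear bound: the lost derivative is recovered with factor `2 K A / M`.
  have hXle : X ≤ ENNReal.ofReal (1 / 2) * X := by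
    calc X ≤ ∫⁻ t in Set.Ioc 0 T', ∑' k, N k * E t k * ∫⁻ σ in Set.Ioc 0 t, G σ k := by
          refine setLIntegral_mono' measurableSet_Ioc fun t ht => ?_
          gcongr with k
          exact hyle t ⟨ht.1.le, ht.2.trans hT'lt.le⟩ k
      _ = ∑' k, ∫⁻ t in Set.Ioc 0 T', N k * E t k * ∫⁻ σ in Set.Ioc 0 t, G σ k := by
          refine lintegral_tsum fun k => ?_
          have hmono : Monotone fun t : ℝ => ∫⁻ σ in Set.Ioc 0 t, G σ k := fun a b hab =>
            lintegral_mono_set (Set.Ioc_subset_Ioc_right hab)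
          exact (((hEm k).const_mul _).mul hmono.measurable).aemeasurable
      _ = ∑' k, ∫⁻ σ in Set.Ioc 0 T', G σ k * ∫⁻ t in Set.Icc σ T', N k * E t k :=
          tsum_congr fun k => lintegral_Ioc_mul_lintegral_Ioc T' ((hEm k).const_mul _) (hGm k)
      _ ≤ ∑' k, ∫⁻ σ in Set.Ioc 0 T', G σ k * (ENNReal.ofReal M⁻¹ * E σ k) := by
          gcongr with k σ
          exact lintegral_weight_le hM0 (freqNorm_nonneg k) σ T'
      _ = ∫⁻ σ in Set.Ioc 0 T', ∑' k, G σ k * (ENNReal.ofReal M⁻¹ * E σ k) :=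
          (lintegral_tsum fun k => ((hGm k).mul ((hEm k).const_mul _)).aemeasurable).symm
      _ = ∫⁻ σ in Set.Ioc 0 T', ENNReal.ofReal M⁻¹ * ∑' k, E σ k * G σ k := by
          refine lintegral_congr fun σ => ?_
          rw [← ENNReal.tsum_mul_left]
          exact tsum_congr fun k => by ring
      _ ≤ ∫⁻ σ in Set.Ioc 0 T', ENNReal.ofReal (1 / 2) * ∑' k, N k * E σ k * y σ k := by
          refine setLIntegral_mono' measurableSet_Ioc fun σ hσ => ?_
          refine (mul_le_mul_right (hGle σ hσ) _).trans ?_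
          rw [← mul_assoc, ← ENNReal.ofReal_mul (by positivity)]
          gcongr
          rw [inv_mul_le_iff₀ hM0, hM]
          linarith
      _ = ENNReal.ofReal (1 / 2) * X :=
          lintegral_const_mul _ (Measurable.tsum fun k =>
            ((hEm k).const_mul _).mul (hym k))
  -- Absorbing `X / 2` requires `X` finite. Both solutions are dominated by `D`, so the integrand is
  -- at most `2 A`.
  have hXfin : X ≠ ⊤ := by
    refine ne_top_of_le_ne_top (b := ∫⁻ _t in Set.Ioc 0 T', 2 * ENNReal.ofReal A) ?_ ?_
    · rw [setLIntegral_const]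
      exact ENNReal.mul_ne_top (by finiteness) (by simp)
    · refine setLIntegral_mono' measurableSet_Ioc fun t ht => ?_
      rw [← hAe, ← ENNReal.tsum_mul_left]
      refine ENNReal.tsum_le_tsum fun k => ?_
      rcases eq_or_ne k 0 with rfl | hk
      · simp [hN, freqNorm_zero]
      have h2 : y t k ≤ 2 * ENNReal.ofReal (D k) := by
        have hle : ∀ {γ : (Fin d → ℤ) → C(Set.Icc (0 : ℝ) Tbar, ℂ)},
            IsModeSolution hTbar.le m F a₀ D γ →
            ‖γ k (Set.projIcc 0 Tbar hTbar.le t)‖ₑ ≤ ENNReal.ofReal (D k) := fun hγ => by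
          rw [← ofReal_norm]
          exact ENNReal.ofReal_le_ofReal
            ((ContinuousMap.norm_coe_le_norm _ _).trans (hγ.norm_le k hk))
        rw [two_mul]
        exact enorm_sub_le.trans (add_le_add (hle hα) (hle hβ))
      calc N k * E t k * y t k
          ≤ N k * ENNReal.ofReal (Real.exp (l * freqNorm k)) * (2 * ENNReal.ofReal (D k)) := by
            gcongr
            exact hEle t ht.1.le k
        _ = _ := by ring
  have hX0 : X = 0 := by
    by_contra hne
    have hlt : ENNReal.ofReal (1 / 2) * X < 1 * X :=
      ENNReal.mul_lt_mul_left hne hXfin (by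
        rw [← ENNReal.ofReal_one]
        exact (ENNReal.ofReal_lt_ofReal_iff one_pos).mpr (by norm_num))
    rw [one_mul] at hlt
    exact absurd hXle (not_le.mpr hlt)
  have hae := (lintegral_eq_zero_iff (Measurable.tsum fun k =>
    ((hEm k).const_mul _).mul (hym k))).mp hX0
  intro t ht k hk
  have haek : (fun t => α k (Set.projIcc 0 Tbar hTbar.le t))
      =ᵐ[volume.restrict (Set.Icc 0 T')] fun t => β k (Set.projIcc 0 Tbar hTbar.le t) := by
    rw [← restrict_Ioc_eq_restrict_Icc]
    filter_upwards [hae] with t ht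
    have h0 := ENNReal.tsum_eq_zero.mp ht k
    have hNk : N k ≠ 0 := by
      have := one_le_freqNorm hk
      simp only [hN, ne_eq, ENNReal.ofReal_eq_zero, not_le]
      linarith
    have hEk : E t k ≠ 0 := by
      simp only [hE, ne_eq, ENNReal.ofReal_eq_zero, not_le]
      exact Real.exp_pos _
    have hyk : y t k = 0 := by
      simpa [hNk, hEk] using h0
    exact sub_eq_zero.mp (enorm_eq_zero.mp hyk)
  -- Vanishing of the integral gives equality for almost every time; continuity of the modes gives
  -- it at every time.
  have heq := Measure.eqOn_Icc_of_ae_eq volume hT'0.ne haek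
    ((α k).continuous.comp hproj).continuousOn ((β k).continuous.comp hproj).continuousOn
    (x := (t : ℝ)) ⟨t.2.1, ht⟩
  simpa using heq

end AnalyticUniqueness

/-! ### Convergence in the Gevrey norm -/

section GevreyConvergence

variable {d : ℕ}

/-- Lower semicontinuity of the norm: finite partial sums pass to the limit, and the full sum is
their supremum. -/
lemma gevreySeqNorm_le_of_tendsto {ι : Type*} {l : Filter ι} [l.NeBot] {s r τ : ℝ} {M : ℝ≥0∞}
    {c : ι → (Fin d → ℤ) → ℂ} {b : (Fin d → ℤ) → ℂ}
    (hc : ∀ k, Tendsto (fun ν => c ν k) l (𝓝 (b k)))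
    (hM : ∀ᶠ ν in l, gevreySeqNorm s r τ (c ν) ≤ M) : gevreySeqNorm s r τ b ≤ M := by
  have hiff : ∀ c : (Fin d → ℤ) → ℂ, gevreySeqNorm s r τ c ≤ M ↔
      ∑' k : {k : Fin d → ℤ // k ≠ 0}, ENNReal.ofReal (freqNorm k.1 ^ (2 * r) *
        Real.exp (2 * τ * freqNorm k.1 ^ (1 / s)) * ‖c k.1‖ ^ 2) ≤ M ^ (2 : ℝ) := by
    intro c
    rw [gevreySeqNorm, one_div (2 : ℝ), ENNReal.rpow_inv_le_iff (by norm_num)]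
  rw [hiff, ENNReal.tsum_eq_iSup_sum]
  refine iSup_le fun u => ?_
  refine le_of_tendsto (tendsto_finsetSum u fun k _ =>
    (ENNReal.continuous_ofReal.tendsto _).comp (((hc k.1).norm.pow 2).const_mul _)) ?_
  filter_upwards [hM] with ν hν
  exact (ENNReal.sum_le_tsum u).trans ((hiff (c ν)).mp hν)

/-- Coefficientwise convergence and a uniform bound with radius `τ` imply convergence in the
Gevrey norm with radius `τ / 2`. -/
lemma tendsto_gevreySeqNorm_half {ι : Type*} {l : Filter ι} {s r τ M : ℝ} (hs : 1 ≤ s)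
    (hτ : 0 < τ) {c : ι → (Fin d → ℤ) → ℂ}
    (hc : ∀ k, k ≠ 0 → Tendsto (fun ν => c ν k) l (𝓝 0))
    (hM : ∀ᶠ ν in l, ∀ k, k ≠ 0 →
      freqNorm k ^ (2 * r) * Real.exp (2 * τ * freqNorm k ^ (1 / s)) * ‖c ν k‖ ^ 2 ≤ M) :
    Tendsto (fun ν => gevreySeqNorm s r (τ / 2) (c ν)) l (𝓝 0) := by
  set f : ι → {k : Fin d → ℤ // k ≠ 0} → ℝ := fun ν k =>
    freqNorm k.1 ^ (2 * r) * Real.exp (2 * (τ / 2) * freqNorm k.1 ^ (1 / s)) * ‖c ν k.1‖ ^ 2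
    with hf
  have hf0 : ∀ ν k, 0 ≤ f ν k := fun ν k => by
    have := freqNorm_nonneg k.1
    positivity
  have hbs : Summable fun k : {k : Fin d → ℤ // k ≠ 0} => gevreyDecay s τ M k.1 :=
    ((rapidDecay_gevreyDecay hs hτ M).summable.of_norm).subtype _
  -- Halving the radius in the squared norm leaves the factor `e^{-τ |k|^{1/s}}`, which serves as
  -- the summable majorant.
  have hle : ∀ᶠ ν in l, ∀ k, ‖f ν k‖ ≤ gevreyDecay s τ M k.1 := by
    filter_upwards [hM] with ν hν k
    rw [Real.norm_of_nonneg (hf0 ν k), gevreyDecay]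
    refine le_trans (le_of_eq ?_)
      (mul_le_mul_of_nonneg_right (hν k.1 k.2) (Real.exp_pos _).le)
    rw [hf]
    simp only
    rw [show 2 * (τ / 2) * freqNorm k.1 ^ (1 / s) = 2 * τ * freqNorm k.1 ^ (1 / s) +
      -(τ * freqNorm k.1 ^ (1 / s)) by ring, Real.exp_add]
    ring
  have hlim : Tendsto (fun ν => ∑' k, f ν k) l (𝓝 0) := by
    have h := tendsto_tsum_of_dominated_convergence (𝓕 := l) (f := f) (g := fun _ => 0) hbs
      (fun k => by
        have := ((hc k.1 k.2).norm.pow 2).const_mul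
          (freqNorm k.1 ^ (2 * r) * Real.exp (2 * (τ / 2) * freqNorm k.1 ^ (1 / s)))
        rw [norm_zero, zero_pow two_ne_zero, mul_zero] at this
        exact this) hle
    simpa using h
  have hlim' := ((ENNReal.continuous_rpow_const (y := 1 / 2)).tendsto _).comp
    ((ENNReal.continuous_ofReal.tendsto _).comp hlim)
  rw [ENNReal.ofReal_zero, ENNReal.zero_rpow_of_pos (by norm_num)] at hlim'
  refine hlim'.congr' ?_
  filter_upwards [hle] with ν hν
  have hsum : Summable (f ν) := .of_norm_bounded hbs hν
  simp only [Function.comp_apply, gevreySeqNorm]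
  rw [ENNReal.ofReal_tsum_of_nonneg (hf0 ν) hsum]

lemma fourierCoefficient_sub {f g : (Fin d → ℝ) → ℝ} (hf : Continuous f) (hg : Continuous g)
    (k : Fin d → ℤ) : fourierCoefficient (fun x => f x - g x) k =
      fourierCoefficient f k - fourierCoefficient g k := by
  have hint : ∀ {f : (Fin d → ℝ) → ℝ}, Continuous f →
      Integrable (fun x => (f x : ℂ) * character (-k) x) (volume.restrict (cell d)) := by
    intro f hf
    have : Continuous fun x => (f x : ℂ) * character (-k) x :=
      (Complex.continuous_ofReal.comp hf).mul (continuous_character _)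
    exact this.continuousOn.integrableOn_compact isCompact_Icc
  simp only [fourierCoefficient_eq]
  rw [← mul_sub, ← integral_sub (hint hf) (hint hg)]
  congr 2
  funext x
  push_cast
  ring

end GevreyConvergence

/-- The modes of any solution of the limit problem, obtained as a limit of modes, agree on a short
time interval with those of a given Gevrey-class solution: for `s = 1` by the analytic energy
estimate, for `s > 1` by the assumed uniqueness. -/
lemma exists_time_modes_eq {d : ℕ} {T : SymbolFamily d}
    {s r τbar Tbar C₀ C : ℝ} {S θ₀ : (Fin d → ℝ) → ℝ} {θ : ℝ → (Fin d → ℝ) → ℝ}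
    (hs : 1 ≤ s) (hTbar : 0 < Tbar) (hτbar : 0 < τbar)
    (hm : ∀ i j k, ‖T 0 i j k‖ ≤ C₀) (hC₀ : 0 ≤ C₀)
    (hT : ∀ i j k, T 0 i j (-k) = (starRingEnd ℂ) (T 0 i j k))
    (hSp : IsPeriodic S) (hSc : Continuous S) (hS : RapidDecay (fourierCoefficient S))
    (hθp : IsPeriodic θ₀) (hθc : Continuous θ₀) (hθ₀ : RapidDecay (fourierCoefficient θ₀))
    {α : (Fin d → ℤ) → C(Set.Icc (0 : ℝ) Tbar, ℂ)}
    (hα : ∀ k (t : Set.Icc (0 : ℝ) Tbar), α k t = fourierCoefficient (θ t) k)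
    (hαs : IsModeSolution hTbar.le (T 0) (fourierCoefficient S) (fourierCoefficient θ₀)
      (gevreyDecay s τbar (max C 0)) α)
    (huniq : 1 < s → ∀ ϑ : ℝ → (Fin d → ℝ) → ℝ,
      IsGevreySolution T 0 s r τbar Tbar S θ₀ ϑ → ∀ t ∈ Set.Icc 0 Tbar, ∀ x, ϑ t x = θ t x) :
    ∃ T' : ℝ, 0 < T' ∧ T' < Tbar ∧ ∀ β : (Fin d → ℤ) → C(Set.Icc (0 : ℝ) Tbar, ℂ),
      IsModeSolution hTbar.le (T 0) (fourierCoefficient S) (fourierCoefficient θ₀)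
        (gevreyDecay s τbar (max C 0)) β →
      (∀ k t, β (-k) t = (starRingEnd ℂ) (β k t)) →
      (∀ t, gevreySeqNorm s r τbar (fun k => β k t) ≤ ENNReal.ofReal C) →
      ∀ t : Set.Icc (0 : ℝ) Tbar, (t : ℝ) ≤ T' → ∀ k, k ≠ 0 → β k t = α k t := by
  rcases hs.eq_or_lt with rfl | hs1
  · obtain ⟨T', h0, h1, h⟩ := exists_time_eq_of_isModeSolution (d := d) hTbar hC₀ hτbar
      (le_max_right C 0)
    exact ⟨T', h0, h1, fun β hβ _ _ => h _ _ _ _ _ hm hβ hαs⟩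
  -- Uniqueness holds on all of `[0,Tbar]`; the half only ensures a time strictly below `Tbar`.
  · refine ⟨Tbar / 2, by linarith, by linarith, fun β hβ hconj hnorm t _ k _ => ?_⟩
    have hD := rapidDecay_gevreyDecay (d := d) hs hτbar (max C 0)
    have hsol := hβ.isGevreySolution hm hC₀ hT hD hSp hSc hS hθp hθc hθ₀ hconj hnorm
    have heq := huniq hs1 _ hsol t t.2
    have hrapid : RapidDecay fun k => β k t := hD.of_le_of_ne_zero fun k hk =>
      (((β k).norm_coe_le_norm t).trans (hβ.norm_le k hk)).trans (le_abs_self _)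
    rw [hα]
    refine (fourierCoefficient_of_eq_fourierSeries hrapid.summable (fun x => ?_) k).symm
    rw [← heq x]
    simp only [Set.projIcc_val]
    exact fourierSeries_conj (fun k => hconj k t) x

end ActiveScalar

end

/-! ### Convergence of the solutions -/

open ActiveScalar

theorem mainTheorem8
    (d : ℕ) (hd : 2 ≤ d)
    (T : ActiveScalar.SymbolFamily d)
    (hreal : ActiveScalar.IsRealFamily T)
    (hA1 : ActiveScalar.CondA1 T)
    (hA2 : ActiveScalar.CondA2 T)
    (hA5 : ActiveScalar.CondA5 T)
    (s r τ₀ K₀ : ℝ) (hs : 1 ≤ s) (hr : (d : ℝ) / 2 + 3 / 2 < r) (hτ₀ : 0 < τ₀) (hK₀ : 0 < K₀)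
    (θ₀ S : (Fin d → ℝ) → ℝ)
    (hθ₀ : ActiveScalar.IsGevrey s r τ₀ θ₀) (hS : ActiveScalar.IsGevrey s r τ₀ S)
    (hθ₀_mean : ActiveScalar.HasZeroMean θ₀) (hS_mean : ActiveScalar.HasZeroMean S)
    (hθ₀_bound : ActiveScalar.gevreyNorm s r τ₀ θ₀ ≤ ENNReal.ofReal K₀)
    (hS_bound : ActiveScalar.gevreyNorm s r τ₀ S ≤ ENNReal.ofReal K₀)
    (Tbar τbar : ℝ) (hTbar : 0 < Tbar) (hτbar : 0 < τbar)
    -- `θ ν` is the solution for the parameter `ν`; in particular `θ 0` solves the limit equation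
    (θ : ℝ → ℝ → (Fin d → ℝ) → ℝ)
    (hsol : ∀ ν ∈ Set.Icc (0 : ℝ) 1,
      ActiveScalar.IsGevreySolution T ν s r τbar Tbar S θ₀ (θ ν))
    (C : ℝ)
    (hbound : ∀ ν ∈ Set.Icc (0 : ℝ) 1, ∀ t ∈ Set.Icc 0 Tbar,
      ActiveScalar.gevreyNorm s r τbar (θ ν t) ≤ ENNReal.ofReal C)
    -- in the non-analytic classes, `θ 0` is the unique solution
    (huniq : 1 < s → ∀ ϑ : ℝ → (Fin d → ℝ) → ℝ,
      ActiveScalar.IsGevreySolution T 0 s r τbar Tbar S θ₀ ϑ →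
        ∀ t ∈ Set.Icc 0 Tbar, ∀ x, ϑ t x = θ 0 t x) :
    ∃ (T' : ℝ) (τ : ℝ → ℝ), 0 < T' ∧ T' < Tbar ∧ ContinuousOn τ (Set.Icc 0 T') ∧
      (∀ t ∈ Set.Icc 0 T', 0 < τ t ∧ τ t < τbar) ∧
      ∀ t ∈ Set.Icc 0 T',
        Filter.Tendsto
          (fun ν : ℝ => ActiveScalar.gevreyNorm s r (τ t) (fun x => θ ν t x - θ 0 t x))
          (nhdsWithin 0 (Set.Ioi 0)) (nhds 0) := by

  have hr0 : 0 ≤ r := by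
    have : (0 : ℝ) ≤ d := Nat.cast_nonneg d
    linarith
  obtain ⟨C₀, hC₀, hA2⟩ := hA2
  have hm : ∀ ν ∈ Set.Icc (0 : ℝ) 1, ∀ i j k, ‖T ν i j k‖ ≤ C₀ := by
    intro ν hν i j k
    rcases hν.1.eq_or_lt with rfl | h
    · exact (hA2 i j k).2
    · exact (hA2 i j k).1 ν h hν.2
  have hS' := hS.rapidDecay hs hr0 hτ₀
  have hθ₀' := hθ₀.rapidDecay hs hr0 hτ₀
  have hmodes : ∀ ν, ∃ α : (Fin d → ℤ) → C(Set.Icc (0 : ℝ) Tbar, ℂ), ν ∈ Set.Icc (0 : ℝ) 1 →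
      (∀ k (t : Set.Icc (0 : ℝ) Tbar), α k t = fourierCoefficient (θ ν t) k) ∧
      IsModeSolution hTbar.le (T ν) (fourierCoefficient S) (fourierCoefficient θ₀)
        (gevreyDecay s τbar (max C 0)) α := by
    intro ν
    by_cases hν : ν ∈ Set.Icc (0 : ℝ) 1
    · obtain ⟨α, hα⟩ := (hsol ν hν).exists_isModeSolution hTbar.le (hm ν hν) hC₀.le (hreal ν hν.1)
        (rapidDecay_gevreyDecay hs hτbar (max C 0)) (gevreyDecay_nonneg (le_max_right _ _))
        (fun t ht k hk => norm_le_gevreyDecay hr0 (hbound ν hν t ht) hk)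
        hS.periodic hS.smooth.continuous hS'
      exact ⟨α, fun _ => hα⟩
    -- Default modes for `ν` outside `[0,1]`, so that the choice is a total function of `ν`.
    · exact ⟨0, fun h => absurd h hν⟩
  choose A hA using hmodes
  have h01 : (0 : ℝ) ∈ Set.Icc (0 : ℝ) 1 := by simp
  obtain ⟨T', hT'0, hT'lt, hlimit⟩ := exists_time_modes_eq (r := r) (C := C) (θ := θ 0)
    hs hTbar hτbar (hm 0 h01) hC₀.le
    (hreal 0 le_rfl) hS.periodic hS.smooth.continuous hS' hθ₀.periodic hθ₀.smooth.continuous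
    hθ₀' (hA 0 h01).1 (hA 0 h01).2 huniq
  have hnear : ∀ᶠ ν in 𝓝[>] (0 : ℝ), ν ∈ Set.Icc (0 : ℝ) 1 :=
    mem_of_superset (Ioc_mem_nhdsGT one_pos) Set.Ioc_subset_Icc_self
  have hconv : ∀ t : Set.Icc (0 : ℝ) Tbar, (t : ℝ) ≤ T' → ∀ k, k ≠ 0 →
      Tendsto (fun ν => A ν k t) (𝓝[>] 0) (𝓝 (A 0 k t)) := by
    intro t ht k hk
    -- Ultrafilters replace extraction of subsequences: compactness gives each of them a limit, and
    -- it is enough that this limit is always the mode of `θ 0`.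
    rw [tendsto_iff_ultrafilter]
    intro U hU
    have hnearU : ∀ᶠ ν in (U : Filter ℝ), ν ∈ Set.Icc (0 : ℝ) 1 := hU hnear
    obtain ⟨β, hβlim, hβ⟩ := exists_tendsto_isModeSolution U
      (hnearU.mono hm) hC₀.le (rapidDecay_gevreyDecay hs hτbar (max C 0))
      (hnearU.mono fun ν hν => (hA ν hν).2) (fun i j k => (hA5.tendsto_symbol i j k).mono_left hU)
    have hβt : ∀ k t, Tendsto (fun ν => A ν k t) U (𝓝 (β k t)) := fun k t =>
      ((continuous_eval_const t).tendsto _).comp (hβlim k)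
    rw [← hlimit β hβ ?_ ?_ t ht k hk]
    · exact hβt k t
    -- Conjugate symmetry passes to the limit, so the limiting modes belong to a real function.
    · intro k t
      refine tendsto_nhds_unique (hβt (-k) t)
        (((Complex.continuous_conj.tendsto _).comp (hβt k t)).congr' ?_)
      filter_upwards [hnearU] with ν hν
      rw [Function.comp_apply, (hA ν hν).1, (hA ν hν).1, fourierCoefficient_neg]
    · intro t
      refine gevreySeqNorm_le_of_tendsto (fun k => hβt k t) ?_
      filter_upwards [hnearU] with ν hν
      simp only [(hA ν hν).1]
      exact hbound ν hν t t.2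
  refine ⟨T', fun _ => τbar / 2, hT'0, hT'lt, continuousOn_const,
    fun t _ => ⟨by linarith, by linarith⟩, fun t ht => ?_⟩
  have htbar : t ∈ Set.Icc 0 Tbar := ⟨ht.1, ht.2.trans hT'lt.le⟩
  have hcoef : ∀ ν ∈ Set.Icc (0 : ℝ) 1, ∀ k,
      fourierCoefficient (fun x => θ ν t x - θ 0 t x) k = A ν k ⟨t, htbar⟩ - A 0 k ⟨t, htbar⟩ := by
    intro ν hν k
    rw [fourierCoefficient_sub ((hsol ν hν).gevrey t htbar).smooth.continuous
      ((hsol 0 h01).gevrey t htbar).smooth.continuous, (hA ν hν).1, (hA 0 h01).1]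
  -- The constant comes from `|a - b|² ≤ 2 (|a|² + |b|²)`, with each weighted square at most `(max C
  -- 0)²`.
  refine tendsto_gevreySeqNorm_half (M := 4 * (max C 0) ^ 2) hs hτbar (fun k hk => ?_) ?_
  · have h := (hconv ⟨t, htbar⟩ ht.2 k hk).sub_const (A 0 k ⟨t, htbar⟩)
    rw [sub_self] at h
    refine h.congr' ?_
    filter_upwards [hnear] with ν hν
    rw [hcoef ν hν]
  · filter_upwards [hnear] with ν hν k hk
    have h1 := sq_weight_le_of_gevreySeqNorm_le (hbound ν hν t htbar) hk
    have h2 := sq_weight_le_of_gevreySeqNorm_le (hbound 0 h01 t htbar) hk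
    rw [fourierCoefficient_sub ((hsol ν hν).gevrey t htbar).smooth.continuous
      ((hsol 0 h01).gevrey t htbar).smooth.continuous]
    set a := fourierCoefficient (θ ν t) k
    set b := fourierCoefficient (θ 0 t) k
    set w := freqNorm k ^ (2 * r) * Real.exp (2 * τbar * freqNorm k ^ (1 / s))
    have hw : 0 ≤ w := by
      have := freqNorm_nonneg k
      positivity
    have h3 : ‖a - b‖ ^ 2 ≤ 2 * (‖a‖ ^ 2 + ‖b‖ ^ 2) :=
      (pow_le_pow_left₀ (norm_nonneg _) (norm_sub_le a b) 2).trans add_sq_le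
    have h4 := mul_le_mul_of_nonneg_left h3 hw
    linarith
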